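/- **Theorem 4.1 (radial Toeplitz operators).** Let $d\ge 2$, let $\mathbb S\subset\mathbb R^d$ be the unit sphere with surface measure $dS$, and for $\varphi\in L_2(\mathbb S)$ put $$(I\varphi)(x)=c_d\int_{\mathbb S}\varphi(\xi)e^{ix\cdot\xi}\,dS(\xi),\qquad c_d=\frac{\sqrt\pi}{(2\pi)^{d/2}},\quad x\in\mathbb R^d .$$ Let $\mathcal H=I(L_2(\mathbb S))$ be the Herglotz space of solutions of $\Delta u+u=0$, with the Hilbert space structure for which $I:L_2(\mathbb S)\to\mathcal H$ is unitary; it is a reproducing kernel Hilbert space of functions on $\mathbb R^d$, and $\kappa_x$ denotes its reproducing kernel, $u(x)=\langle u,\kappa_x\rangle$. Let $N_{0,d}=1$ and $N_{n,d}=\frac{(2n+d-2)(n+d-3)!}{n!\,(d-2)!}$ for $n\ge1$. For every $n\in\mathbb Z_+$ let $Y_{n,1},\dots,Y_{n,N_{n,d}}$ be real spherical harmonics of degree $n$ (restrictions to $\mathbb S$ of real harmonic homogeneous polynomials of degree $n$) that are orthonormal in $L_2(\mathbb S)$, and put $\mathbf e_{n,j}=I\,Y_{n,j}$ and $\mathbb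 H_n^d=\mathrm{span}\{\mathbf e_{n,1},\dots,\mathbf e_{n,N_{n,d}}\}$. Let $a$ be a complex-valued function of $r\ge 0$ such that $x\mapsto a(|x|)$ is locally integrable on $\mathbb R^d$. Suppose that for every $n\in\mathbb Z_+$ the improper integral $$\gamma_a(n)=\pi\int_0^\infty a(r)\,J_{n+(d-2)/2}(r)^2\,r\,dr=\pi\lim_{R\to\infty}\int_0^R a(r)\,J_{n+(d-2)/2}(r)^2\,r\,dr$$ converges ($J_\nu$ is the Bessel function of the first kind), and that the sequence $\gamma_a=\{\gamma_a(n)\}_{n\in\mathbb Z_+}$ is bounded. Put $$F_a(u,v)=\int_{\mathbb R^d}a(|x|)u(x)\overline{v(x)}\,dx=\lim_{R\to\infty}\int_{|x|<R}a(|x|)u(x)\overline{v(x)}\,dx$$ whenever the limit exists. Then the $\mathbf e_{n,j}$ ($n\in\mathbb Z_+$, $1\le j\le N_{n,d}$) form an orthonormal basis of $\mathcal H$; the Toeplitz operator $(T_au)(x)=F_a(u,\kappa_x)$ is well defined (the limit exists for every $x\in\mathbb R^d$) for every finite linear combination $u$ of the $\mathbf e_{n,j}$, and it extends in one and only one way to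 a bounded operator on $\mathcal H$, again denoted by $T_a$. This operator has the following properties. - $T_a$ is diagonal with respect to the basis $\{\mathbf e_{n,j}\}$: $T_a\mathbf e_{n,j}=\gamma_a(n)\,\mathbf e_{n,j}$ for all $n,j$. - Every $\gamma_a(n)$ is an eigenvalue of $T_a$, the space $\mathbb H_n^d$ consists of vectors $u$ with $T_au=\gamma_a(n)u$, and $\dim\mathbb H_n^d=N_{n,d}$. The whole eigenspace $\ker(T_a-\gamma_a(n))$ is the closed linear span of the spaces $\mathbb H_m^d$ with $\gamma_a(m)=\gamma_a(n)$; in particular, if $\gamma_a(m)\ne\gamma_a(n)$ for all $m\neq n$, then the eigenspace is $\mathbb H_n^d$ and the multiplicity of $\gamma_a(n)$ is $N_{n,d}$. - The spectrum of $T_a$ is the closure of $\{\gamma_a(n):n\in\mathbb Z_+\}$. - $T_a$ is compact if and only if $\gamma_a(n)\to0$ as $n\to\infty$. -/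

import Mathlib

open MeasureTheory Filter Topology
open scoped ComplexConjugate ENNReal

noncomputable section

namespace HerglotzToeplitz

/-- Euclidean space `ℝ^d`. -/
abbrev E (d : ℕ) : Type := EuclideanSpace ℝ (Fin d)

/-- The unit sphere of `ℝ^d`. -/
abbrev S (d : ℕ) : Type := Metric.sphere (0 : E d) 1

/-- The surface (Lebesgue) measure on the unit sphere. -/
abbrev surf (d : ℕ) : Measure (S d) := (volume : Measure (E d)).toSphere

/-- The space `L_2` of complex valued functions on the unit sphere. -/
abbrev L2S (d : ℕ) : Type := Lp ℂ 2 (surf d)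

/-- The normalizing constant `√π / (2π)^(d/2)`. -/
def herglotzConst (d : ℕ) : ℝ := √Real.pi / (2 * Real.pi) ^ ((d : ℝ) / 2)

/-- `(I φ)(x) = c_d ∫ φ(ξ) exp(i x·ξ) dS(ξ)`, the Herglotz wave function with density `φ`. -/
def herglotzWave (d : ℕ) (φ : S d → ℂ) (x : E d) : ℂ :=
  (herglotzConst d : ℂ) *
    ∫ ξ, φ ξ * Complex.exp (Complex.I * ((inner ℝ x (ξ : E d) : ℝ) : ℂ)) ∂(surf d)

/-- The function `ξ ↦ exp(-i x·ξ)` on the sphere. -/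
def planeWave (d : ℕ) (x : E d) : C(S d, ℂ) where
  toFun ξ := Complex.exp (-(Complex.I * ((inner ℝ x (ξ : E d) : ℝ) : ℂ)))
  continuous_toFun := by fun_prop

lemma conj_planeWave (d : ℕ) (x : E d) (ξ : S d) :
    conj (planeWave d x ξ) = Complex.exp (Complex.I * ((inner ℝ x (ξ : E d) : ℝ) : ℂ)) := by
  simp [planeWave, ← Complex.exp_conj]

lemma herglotzWave_eq_inner (d : ℕ) (φ : L2S d) (x : E d) :
    herglotzWave d φ x =
      (herglotzConst d : ℂ) * inner ℂ (ContinuousMap.toLp 2 (surf d) ℂ (planeWave d x)) φ := by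
  rw [herglotzWave, MeasureTheory.L2.inner_def]
  congr 1
  apply integral_congr_ae
  filter_upwards [ContinuousMap.coeFn_toLp (p := 2) (𝕜 := ℂ) (surf d) (planeWave d x)] with ξ h
  rw [h, RCLike.inner_apply', ← conj_planeWave, mul_comm]

/-- The operator `I` as a linear map from `L_2` of the sphere to functions on `ℝ^d`. -/
def herglotzMap (d : ℕ) : L2S d →ₗ[ℂ] (E d → ℂ) where
  toFun φ := herglotzWave d φ
  map_add' φ ψ := by
    funext x
    simp only [herglotzWave_eq_inner, Pi.add_apply, inner_add_right]
    ring
  map_smul' c φ := by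
    funext x
    simp only [herglotzWave_eq_inner, Pi.smul_apply, inner_smul_right, smul_eq_mul,
      RingHom.id_apply]
    ring

lemma herglotzConst_ne_zero (d : ℕ) : herglotzConst d ≠ 0 := by
  unfold herglotzConst
  positivity

lemma planeWave_add (d : ℕ) (x y : E d) :
    planeWave d (x + y) = planeWave d x * planeWave d y := by
  ext ξ
  simp only [planeWave, ContinuousMap.coe_mk, ContinuousMap.mul_apply, ← Complex.exp_add,
    inner_add_left]
  congr 1
  push_cast
  ring

/-- The linear span of the plane waves, as a star subalgebra of the continuous functions. -/
def planeWaveAlgebra (d : ℕ) : StarSubalgebra ℂ C(S d, ℂ) where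
  toSubalgebra := (Submodule.span ℂ (Set.range (planeWave d))).toSubalgebra
    (Submodule.subset_span ⟨0, by ext ξ; simp [planeWave]⟩)
    (fun f g hf hg => by
      have h := Submodule.mul_mem_mul hf hg
      rw [Submodule.span_mul_span] at h
      refine Submodule.span_mono ?_ h
      rintro _ ⟨_, ⟨x, rfl⟩, _, ⟨y, rfl⟩, rfl⟩
      exact ⟨x + y, planeWave_add d x y⟩)
  star_mem' := by
    intro f hf
    change star f ∈ Submodule.span ℂ (Set.range (planeWave d))
    replace hf : f ∈ Submodule.span ℂ (Set.range (planeWave d)) := hf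
    induction hf using Submodule.span_induction with
    | mem f h =>
      obtain ⟨x, rfl⟩ := h
      refine Submodule.subset_span ⟨-x, ?_⟩
      ext ξ
      rw [ContinuousMap.star_apply, Complex.star_def, conj_planeWave]
      simp [planeWave]
    | zero => simp
    | add f g _ _ hf hg => rw [star_add]; exact add_mem hf hg
    | smul c f _ hf => rw [star_smul]; exact Submodule.smul_mem _ _ hf

lemma planeWaveAlgebra_separatesPoints (d : ℕ) :
    (planeWaveAlgebra d).SeparatesPoints := by
  intro ξ η hne
  by_contra hcon
  push Not at hcon
  have key : ∀ x : E d, planeWave d x ξ = planeWave d x η := fun x =>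
    hcon _ ⟨planeWave d x, Submodule.subset_span ⟨x, rfl⟩, rfl⟩
  have hv : ((ξ : E d) - η) ≠ 0 := sub_ne_zero.2 (fun h => hne (Subtype.ext h))
  have hn : ‖(ξ : E d) - η‖ ≠ 0 := norm_ne_zero_iff.2 hv
  have h := key ((‖(ξ : E d) - η‖ ^ 2)⁻¹ • ((ξ : E d) - η))
  simp only [planeWave, ContinuousMap.coe_mk, inner_smul_left, RCLike.conj_to_real] at h
  rw [Complex.exp_eq_exp_iff_exists_int] at h
  obtain ⟨n, hn'⟩ := h
  have h2 : (‖(ξ : E d) - η‖ ^ 2)⁻¹ * inner ℝ ((ξ : E d) - η) (ξ : E d)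
      - (‖(ξ : E d) - η‖ ^ 2)⁻¹ * inner ℝ ((ξ : E d) - η) (η : E d) = 1 := by
    rw [← mul_sub, ← inner_sub_right, real_inner_self_eq_norm_sq]
    field_simp
  have h4 : (n : ℝ) * (2 * Real.pi) = -1 := by
    generalize (‖(ξ : E d) - η‖ ^ 2)⁻¹ * inner ℝ ((ξ : E d) - η) (ξ : E d) = s at h2 hn'
    generalize (‖(ξ : E d) - η‖ ^ 2)⁻¹ * inner ℝ ((ξ : E d) - η) (η : E d) = t at h2 hn'
    have h3 := congrArg Complex.im hn'
    simp at h3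
    linarith
  have hpi := Real.pi_gt_three
  rcases lt_trichotomy n 0 with h0 | h0 | h0
  · have : (n : ℝ) ≤ -1 := by exact_mod_cast (by omega : n ≤ -1)
    nlinarith
  · subst h0
    norm_num at h4
  · have : (1 : ℝ) ≤ n := by exact_mod_cast h0
    nlinarith

lemma herglotzMap_injective (d : ℕ) : Function.Injective (herglotzMap d) := by
  rw [injective_iff_map_eq_zero]
  intro φ hφ
  have hsw : (Submodule.span ℂ (Set.range (planeWave d))).topologicalClosure = ⊤ :=
    congr_arg (Subalgebra.toSubmodule <| StarSubalgebra.toSubalgebra ·)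
      (ContinuousMap.starSubalgebra_topologicalClosure_eq_top_of_separatesPoints
        (planeWaveAlgebra d) (planeWaveAlgebra_separatesPoints d))
  have hd := (ContinuousMap.toLp_denseRange ℂ (surf d) ℂ
    (p := 2) (by simp)).topologicalClosure_map_submodule hsw
  have horth : φ ∈ ((Submodule.span ℂ (Set.range (planeWave d))).map
      (ContinuousMap.toLp 2 (surf d) ℂ : C(S d, ℂ) →L[ℂ] L2S d).toLinearMap)ᗮ := by
    rw [Submodule.mem_orthogonal, Submodule.map_span]
    intro u hu
    induction hu using Submodule.span_induction with
    | mem u h =>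
      obtain ⟨_, ⟨x, rfl⟩, rfl⟩ := h
      have h1 : herglotzWave d φ x = 0 := congrFun hφ x
      rw [herglotzWave_eq_inner, mul_eq_zero] at h1
      exact h1.resolve_left (by exact_mod_cast herglotzConst_ne_zero d)
    | zero => simp
    | add u v _ _ hu hv => rw [inner_add_left, hu, hv, add_zero]
    | smul c u _ hu => rw [inner_smul_left, hu, mul_zero]
  rw [← Submodule.orthogonal_closure, hd] at horth
  simpa using horth

/-- The Herglotz space: all functions `I φ` on `ℝ^d` with `φ` in `L_2` of the sphere. -/
def Herglotz (d : ℕ) : Type := LinearMap.range (herglotzMap d)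

instance (d : ℕ) : AddCommGroup (Herglotz d) :=
  inferInstanceAs (AddCommGroup (LinearMap.range (herglotzMap d)))

instance (d : ℕ) : Module ℂ (Herglotz d) :=
  inferInstanceAs (Module ℂ (LinearMap.range (herglotzMap d)))

/-- The bijection `I` from `L_2` of the sphere onto the Herglotz space. -/
def herglotzEquiv (d : ℕ) : L2S d ≃ₗ[ℂ] Herglotz d :=
  LinearEquiv.ofInjective (herglotzMap d) (herglotzMap_injective d)

/-- The norm of `I φ` is the norm of `φ` in `L_2` of the sphere. -/
instance (d : ℕ) : NormedAddCommGroup (Herglotz d) :=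
  NormedAddCommGroup.induced (Herglotz d) (L2S d) (herglotzEquiv d).symm
    (herglotzEquiv d).symm.injective

/-- The scalar product of `I φ` and `I ψ` is that of `φ` and `ψ` in `L_2` of the sphere. -/
instance (d : ℕ) : InnerProductSpace ℂ (Herglotz d) where
  toNormedSpace := NormedSpace.induced ℂ (Herglotz d) (L2S d) (herglotzEquiv d).symm.toLinearMap
  inner u v := inner ℂ ((herglotzEquiv d).symm u) ((herglotzEquiv d).symm v)
  norm_sq_eq_re_inner u := norm_sq_eq_re_inner (𝕜 := ℂ) ((herglotzEquiv d).symm u)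
  conj_inner_symm u v := inner_conj_symm (𝕜 := ℂ) _ _
  add_left u v w := by simp only [map_add, inner_add_left]
  smul_left u v c := by simp only [map_smul, inner_smul_left]

/-- The operator `I` as a unitary map from `L_2` of the sphere onto the Herglotz space. -/
def herglotzUnitary (d : ℕ) : L2S d ≃ₗᵢ[ℂ] Herglotz d where
  toLinearEquiv := herglotzEquiv d
  norm_map' φ := by
    change ‖(herglotzEquiv d).symm (herglotzEquiv d φ)‖ = ‖φ‖
    rw [LinearEquiv.symm_apply_apply]

instance (d : ℕ) : CompleteSpace (Herglotz d) :=
  (herglotzUnitary d).toIsometryEquiv.completeSpace_iff.1 inferInstance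

/-- An element of the Herglotz space is a function on `ℝ^d`, and point evaluations are continuous;
thus the Herglotz space is a reproducing kernel Hilbert space. -/
instance (d : ℕ) : RKHS ℂ (Herglotz d) (E d) ℂ where
  coeCLM :=
    { toLinearMap := (LinearMap.range (herglotzMap d)).subtype
      cont := by
        refine continuous_pi fun x => ?_
        have h : (fun u : Herglotz d => (u : LinearMap.range (herglotzMap d)).1 x) =
            fun u => (herglotzConst d : ℂ) *
              inner ℂ (ContinuousMap.toLp 2 (surf d) ℂ (planeWave d x))
                ((herglotzUnitary d).symm u) := by
          funext u
          rw [← herglotzWave_eq_inner]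
          exact congrFun (congrArg Subtype.val ((herglotzEquiv d).apply_symm_apply u)).symm x
        change Continuous fun u : Herglotz d => (u : LinearMap.range (herglotzMap d)).1 x
        rw [h]
        fun_prop }
  coeCLM_injective := Subtype.val_injective

lemma herglotzUnitary_apply (d : ℕ) (φ : L2S d) (x : E d) :
    herglotzUnitary d φ x = herglotzWave d φ x := rfl

/-- The reproducing kernel `κ_x` of the Herglotz space: `u x = ⟪κ_x, u⟫` for every `u`. -/
def reproKernel (d : ℕ) (x : E d) : Herglotz d := RKHS.kerFun (Herglotz d) x 1

/-- The Bessel function `J_ν` of the first kind, for real order and real argument `r ≥ 0`. -/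
def besselJ (ν r : ℝ) : ℝ :=
  ∑' k : ℕ, (-1) ^ k / ((k.factorial : ℝ) * Real.Gamma (k + ν + 1)) * (r / 2) ^ (2 * k + ν)

/-- The number `N_{n,d}`, for `d ≥ 2`. -/
def harmonicDim (d n : ℕ) : ℕ :=
  if n = 0 then 1
  else (2 * n + d - 2) * (n + d - 3).factorial / (n.factorial * (d - 2).factorial)

/-- `f` is a real spherical harmonic of degree `n`: the restriction to the unit sphere of a
harmonic homogeneous polynomial of degree `n`. -/
def IsSphericalHarmonic (d n : ℕ) (f : S d → ℝ) : Prop :=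
  ∃ p : MvPolynomial (Fin d) ℝ, p.IsHomogeneous n ∧
    ∑ i, MvPolynomial.pderiv i (MvPolynomial.pderiv i p) = 0 ∧
    ∀ ξ : S d, f ξ = MvPolynomial.eval (fun i => (ξ : E d) i) p

/-- For every degree `n`, the functions `Y n j`, `j = 1, …, N_{n,d}`, are real spherical harmonics
of degree `n` and are orthonormal in `L_2` of the sphere. -/
def IsHarmonicSystem (d : ℕ) (Y : (n : ℕ) → Fin (harmonicDim d n) → C(S d, ℝ)) : Prop :=
  ∀ n, (∀ j, IsSphericalHarmonic d n (Y n j)) ∧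
    ∀ j k, ∫ ξ, Y n j ξ * Y n k ξ ∂(surf d) = if j = k then 1 else 0

/-- A real continuous function on the sphere as an element of the complex `L_2`. -/
def toL2S (d : ℕ) (f : C(S d, ℝ)) : L2S d :=
  ContinuousMap.toLp 2 (surf d) ℂ ⟨fun ξ => (f ξ : ℂ), by fun_prop⟩

/-- `e_{n,j} = I Y_{n,j}`. -/
def basisVec (d : ℕ) (Y : (n : ℕ) → Fin (harmonicDim d n) → C(S d, ℝ)) (n : ℕ)
    (j : Fin (harmonicDim d n)) : Herglotz d :=
  herglotzUnitary d (toL2S d (Y n j))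

/-- The span of `e_{n,1}, …, e_{n,N}`, with `N = N_{n,d}`. -/
def harmonicSpace (d : ℕ) (Y : (n : ℕ) → Fin (harmonicDim d n) → C(S d, ℝ)) (n : ℕ) :
    Submodule ℂ (Herglotz d) :=
  Submodule.span ℂ (Set.range (basisVec d Y n))

/-- The finite linear combinations of all the `e_{n,j}`. -/
def finiteCombinations (d : ℕ) (Y : (n : ℕ) → Fin (harmonicDim d n) → C(S d, ℝ)) :
    Submodule ℂ (Herglotz d) :=
  Submodule.span ℂ (Set.range fun p : (n : ℕ) × Fin (harmonicDim d n) => basisVec d Y p.1 p.2)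

/-- `F_a(u, v) = ∫ a(|x|) u(x) conj(v(x)) dx` exists, as the limit of the integrals over the balls
`|x| < R` for `R → ∞`, and has the value `L`. -/
def HasForm (d : ℕ) (a : ℝ → ℂ) (u v : Herglotz d) (L : ℂ) : Prop :=
  Tendsto (fun R : ℝ => ∫ x in Metric.ball (0 : E d) R, a ‖x‖ * u x * conj (v x)) atTop (𝓝 L)

/-- `T` is an extension of the Toeplitz operator with symbol `a(|x|)`, which is given by
`(T_a u)(x) = F_a(u, κ_x)` for the finite linear combinations `u` of the `e_{n,j}`. -/
def ExtendsToeplitz (d : ℕ) (a : ℝ → ℂ) (Y : (n : ℕ) → Fin (harmonicDim d n) → C(S d, ℝ))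
    (T : Herglotz d →L[ℂ] Herglotz d) : Prop :=
  ∀ u ∈ finiteCombinations d Y, ∀ x : E d, HasForm d a u (reproKernel d x) (T u x)

/-- `γ n = π ∫_0^∞ a(r) J_{n+(d-2)/2}(r)² r dr` for every `n`, where the integrals converge as
improper integrals `lim_{R → ∞} ∫_0^R`. -/
def IsSpectralSequence (d : ℕ) (a : ℝ → ℂ) (γ : ℕ → ℂ) : Prop :=
  ∀ n : ℕ, Tendsto
    (fun R : ℝ => (Real.pi : ℂ) *
      ∫ r in (0 : ℝ)..R, a r * ((besselJ (n + ((d : ℝ) - 2) / 2) r ^ 2 * r : ℝ) : ℂ))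
    atTop (𝓝 (γ n))

end HerglotzToeplitz

end

open HerglotzToeplitz

/-!
# Radial Toeplitz operators on the Herglotz space

In polar coordinates a Herglotz wave with a spherical harmonic `Y` of degree `n` as its density is
`√π i^n r^(-(d-2)/2) J_{n+(d-2)/2}(r) Y(η)` (`herglotzWave_polyL2_smul`). Integrating `Y` against
the reproducing kernel over the sphere of radius `r` gives back the same wave, times the complex
conjugate of the radial factor (`integral_polyFun_mul_reproKernel`). Hence for a radial symbol `a`
the form `F_a(e_{n,j}, κ_x)`, cut off at radius `R`, is exactly
`π ∫₀^R a(r) J_{n+(d-2)/2}(r)² r dr · e_{n,j}(x)` (`setIntegral_ball_herglotzWave`), and the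
Toeplitz operator is diagonal. The other assertions hold for every bounded operator that is diagonal
in a Hilbert basis (`diagonalOp`), applied to the basis `e_{n,j}`.

The facts on spherical harmonics are all derived from the Gaussian weight `exp(-|x|²/2)`, against
which integration by parts reads `∫ xᵢ p = ∫ ∂ᵢ p` (`gaussInt_X_mul`); polar coordinates turn
Gaussian integrals of homogeneous polynomials into integrals over the sphere
(`gaussInt_eq_gaussRadial_mul_sphereInt`).

* With Euler's identity, a harmonic homogeneous polynomial is orthogonal to all homogeneous
  polynomials of lower degree (`sphereInt_mul_eq_zero`). In particular harmonics of different
  degrees are orthogonal.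
* The moments `∫ p(y) (x·y)^m` of a harmonic `p` satisfy a two-term recursion whose solution gives,
  term by term, the power series of the Bessel function (`sphereInt_harmonic_mul_linForm_pow`).
* A harmonic polynomial `|x|² q` vanishes, being orthogonal on the sphere to `q`, that is, to
  itself. So `q ↦ Δ(|x|² q)` is bijective on homogeneous polynomials of each degree. This gives the
  decomposition of polynomials into harmonics (`exists_sub_normSqPoly_mul_mem_harmonicPoly`) and the
  dimension `N_{n,d}` (`finrank_harmonicPoly`). By the dimension, the given `Y_{n,j}` span all
  harmonics of degree `n`; by the decomposition and the expansion of plane waves into powers of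
  linear forms, harmonics are complete in `L_2` of the sphere (`eq_zero_of_orthogonal_harmonics`).
-/

noncomputable section

namespace HerglotzToeplitz

/-! ### Polynomial functions and the Gaussian functional -/

/-- The polynomial function on Euclidean space given by a real polynomial. -/
def polyFun {d : ℕ} (p : MvPolynomial (Fin d) ℝ) (x : E d) : ℝ :=
  MvPolynomial.eval (fun i => x i) p

section PolyFun

open MvPolynomial

variable {d : ℕ} (p q : MvPolynomial (Fin d) ℝ) (x : E d)

@[simp] lemma polyFun_add : polyFun (p + q) x = polyFun p x + polyFun q x := by simp [polyFun]
@[simp] lemma polyFun_mul : polyFun (p * q) x = polyFun p x * polyFun q x := by simp [polyFun]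
@[simp] lemma polyFun_pow (n : ℕ) : polyFun (p ^ n) x = polyFun p x ^ n := by simp [polyFun]
@[simp] lemma polyFun_C (c : ℝ) : polyFun (C c) x = c := by simp [polyFun]
@[simp] lemma polyFun_zero : polyFun 0 x = 0 := by simp [polyFun]
@[simp] lemma polyFun_one : polyFun 1 x = 1 := by simp [polyFun]
@[simp] lemma polyFun_natCast (n : ℕ) : polyFun (n : MvPolynomial (Fin d) ℝ) x = n := by
  simp [polyFun]
@[simp] lemma polyFun_X (i : Fin d) : polyFun (X i) x = x i := by simp [polyFun]
@[simp] lemma polyFun_sum {ι : Type*} (s : Finset ι) (f : ι → MvPolynomial (Fin d) ℝ) :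
    polyFun (∑ i ∈ s, f i) x = ∑ i ∈ s, polyFun (f i) x := by simp [polyFun]
@[simp] lemma polyFun_smul (c : ℝ) : polyFun (c • p) x = c * polyFun p x := by simp [polyFun]

lemma polyFun_homogeneous {n : ℕ} (hp : p.IsHomogeneous n) (r : ℝ) :
    polyFun p (r • x) = r ^ n * polyFun p x := by
  simp only [polyFun, MvPolynomial.eval_eq, Finset.mul_sum]
  refine Finset.sum_congr rfl fun m hm => ?_
  have h : ∑ i, m i = n := by
    have := hp.degree_eq_sum_deg_support hm
    rw [this]
    exact (Finset.sum_subset (Finset.subset_univ _) fun i _ hi =>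
      Finsupp.notMem_support_iff.1 hi).symm
  simp only [PiLp.smul_apply, smul_eq_mul, mul_pow, Finset.prod_mul_distrib]
  rw [Finset.prod_subset (Finset.subset_univ m.support) (f := fun i => r ^ m i),
    Finset.prod_pow_eq_pow_sum, h]
  · ring
  · intro i _ hi
    simp [Finsupp.notMem_support_iff.1 hi]

lemma hasFDerivAt_polyFun :
    HasFDerivAt (polyFun p)
      (∑ i, polyFun (pderiv i p) x • (EuclideanSpace.proj i : E d →L[ℝ] ℝ)) x := by
  induction p using MvPolynomial.induction_on with
  | C a =>
    have : polyFun (d := d) (C a) = fun _ => a := by ext; simp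
    rw [this]
    simpa using hasFDerivAt_const a x
  | add p q hp hq =>
    have : polyFun (d := d) (p + q) = fun x => polyFun p x + polyFun q x := by ext; simp
    rw [this]
    refine (hp.fun_add hq).congr_fderiv ?_
    simp [add_smul, Finset.sum_add_distrib]
  | mul_X p j hp =>
    have : polyFun (d := d) (p * X j) = fun x => polyFun p x * x j := by ext; simp
    rw [this]
    refine (hp.fun_mul (EuclideanSpace.proj (𝕜 := ℝ) j : E d →L[ℝ] ℝ).hasFDerivAt).congr_fderiv ?_
    simp only [pderiv_mul, polyFun_add, polyFun_mul, polyFun_X, add_smul, Finset.sum_add_distrib]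
    rw [add_comm, Finset.smul_sum]
    congr 1
    · refine Finset.sum_congr rfl fun i _ => ?_
      rw [smul_smul, mul_comm]
      rfl
    · rw [Finset.sum_eq_single j]
      · simp
      · intro i _ hi
        simp [pderiv_X_of_ne hi.symm]
      · simp

lemma differentiable_polyFun : Differentiable ℝ (polyFun p) :=
  fun x => (hasFDerivAt_polyFun p x).differentiableAt

lemma continuous_polyFun : Continuous (polyFun p) := (differentiable_polyFun p).continuous

lemma fderiv_polyFun_single (i : Fin d) :
    fderiv ℝ (polyFun p) x (EuclideanSpace.single i 1) = polyFun (pderiv i p) x := by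
  rw [(hasFDerivAt_polyFun p x).fderiv]
  simp [_root_.sum_apply]

lemma exists_norm_polyFun_le : ∃ C : ℝ, ∃ N : ℕ, 0 ≤ C ∧
    ∀ x : E d, ‖polyFun p x‖ ≤ C * (1 + ‖x‖) ^ N := by
  induction p using MvPolynomial.induction_on with
  | C a => exact ⟨‖a‖, 0, norm_nonneg _, fun x => by simp⟩
  | add p q hp hq =>
    obtain ⟨C, N, hC, h⟩ := hp
    obtain ⟨C', N', hC', h'⟩ := hq
    refine ⟨C + C', N + N', by positivity, fun x => ?_⟩
    rw [polyFun_add, add_mul]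
    have h1 : 1 ≤ 1 + ‖x‖ := by linarith [norm_nonneg x]
    refine (norm_add_le _ _).trans (add_le_add ((h x).trans ?_) ((h' x).trans ?_)) <;>
    · gcongr
      omega
  | mul_X p j hp =>
    obtain ⟨C, N, hC, h⟩ := hp
    refine ⟨C, N + 1, hC, fun x => ?_⟩
    rw [polyFun_mul, norm_mul, pow_succ, ← mul_assoc, polyFun_X]
    have : ‖x j‖ ≤ 1 + ‖x‖ := (PiLp.norm_apply_le x j).trans (by linarith)
    gcongr
    exact h x

/-- The Gaussian weight `exp (-|x|² / 2)`. -/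
def gaussWeight {d : ℕ} (x : E d) : ℝ := Real.exp (-(1 / 2) * ‖x‖ ^ 2)

lemma integrable_polyFun_mul_gaussWeight :
    Integrable (fun x : E d => polyFun p x * gaussWeight x) := by
  obtain ⟨C, N, hC, h⟩ := exists_norm_polyFun_le p
  have hg : Integrable (fun x : E d => Real.exp (-(1 / 4) * ‖x‖ ^ 2)) := by
    have := (GaussianFourier.integrable_cexp_neg_mul_sq_norm_add (V := E d) (b := (1 / 4 : ℂ))
      (by norm_num) 0 0).norm
    refine this.congr (ae_of_all _ fun x => ?_)
    simp [Complex.norm_exp, ← Complex.ofReal_pow]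
  refine (hg.const_mul (C * (N.factorial * Real.exp 2))).mono'
    ((continuous_polyFun p).mul (by unfold gaussWeight; fun_prop)).aestronglyMeasurable
    (ae_of_all _ fun x => ?_)
  rw [norm_mul, mul_assoc]
  have h1 : (1 + ‖x‖) ^ N ≤ N.factorial * Real.exp (1 + ‖x‖) := by
    have := Real.pow_div_factorial_le_exp (1 + ‖x‖) (by positivity) N
    rwa [div_le_iff₀ (by positivity), mul_comm] at this
  calc ‖polyFun p x‖ * ‖gaussWeight x‖
      ≤ (C * (N.factorial * Real.exp (1 + ‖x‖))) * gaussWeight x := by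
        rw [gaussWeight, Real.norm_of_nonneg (Real.exp_pos _).le]
        gcongr
        exact (h x).trans (by gcongr)
    _ = C * (N.factorial * Real.exp (1 + ‖x‖ + -(1 / 2) * ‖x‖ ^ 2)) := by
        rw [Real.exp_add (1 + ‖x‖), gaussWeight]; ring
    _ ≤ C * (N.factorial * Real.exp (2 + -(1 / 4) * ‖x‖ ^ 2)) := by
        gcongr C * (N.factorial * Real.exp ?_)
        nlinarith [sq_nonneg (‖x‖ - 2)]
    _ = _ := by rw [Real.exp_add]; ring

/-- The functional `p ↦ ∫ p(x) exp(-|x|²/2) dx` on polynomials. -/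
def gaussInt {d : ℕ} : MvPolynomial (Fin d) ℝ →ₗ[ℝ] ℝ where
  toFun p := ∫ x : E d, polyFun p x * gaussWeight x
  map_add' p q := by
    simp only [polyFun_add, add_mul]
    exact integral_add (integrable_polyFun_mul_gaussWeight p)
      (integrable_polyFun_mul_gaussWeight q)
  map_smul' c p := by
    simp only [polyFun_smul, mul_assoc, RingHom.id_apply, smul_eq_mul]
    exact integral_const_mul _ _

lemma gaussInt_apply : gaussInt p = ∫ x : E d, polyFun p x * gaussWeight x := rfl

lemma gaussInt_C_mul (c : ℝ) : gaussInt (C c * p) = c * gaussInt p := by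
  rw [← smul_eq_C_mul, map_smul, smul_eq_mul]

lemma gaussInt_one : gaussInt (1 : MvPolynomial (Fin d) ℝ) = (2 * Real.pi) ^ ((d : ℝ) / 2) := by
  have := GaussianFourier.integral_rexp_neg_mul_sq_norm (V := E d) (b := 1 / 2) (by norm_num)
  simp only [gaussInt_apply, polyFun_one, one_mul, gaussWeight]
  rw [this, finrank_euclideanSpace_fin]
  congr 1
  ring

/-- Integration by parts against the Gaussian weight. -/
lemma gaussInt_X_mul (i : Fin d) : gaussInt (X i * p) = gaussInt (pderiv i p) := by
  have hG : ∀ x : E d, HasFDerivAt (gaussWeight (d := d))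
      (gaussWeight x • (-(1 / 2 : ℝ)) • (2 • (innerSL ℝ x : E d →L[ℝ] ℝ))) x := fun x =>
    (((hasStrictFDerivAt_norm_sq x).hasFDerivAt).const_mul (-(1 / 2 : ℝ))).exp
  have hG' : ∀ x : E d, fderiv ℝ (gaussWeight (d := d)) x (EuclideanSpace.single i 1)
      = -(x i * gaussWeight x) := by
    intro x
    rw [(hG x).fderiv]
    simp [EuclideanSpace.inner_single_right]
    ring
  have key := integral_mul_fderiv_eq_neg_fderiv_mul_of_integrable (μ := (volume : Measure (E d)))
    (f := polyFun p) (g := gaussWeight) (v := EuclideanSpace.single i 1)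
    (by simpa only [fderiv_polyFun_single] using integrable_polyFun_mul_gaussWeight (pderiv i p))
    (by
      simp only [hG']
      refine (integrable_polyFun_mul_gaussWeight (X i * p)).neg.congr (ae_of_all _ fun x => ?_)
      simp only [Pi.neg_apply, polyFun_mul, polyFun_X]
      ring)
    (integrable_polyFun_mul_gaussWeight p)
    (fun x _ => differentiable_polyFun p x) (fun x _ => (hG x).differentiableAt)
  simp only [hG', fderiv_polyFun_single] at key
  rw [gaussInt_apply, gaussInt_apply, ← neg_eq_iff_eq_neg.2 key, ← integral_neg]
  congr 1
  ext x
  simp only [polyFun_mul, polyFun_X]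
  ring

end PolyFun

/-! ### Harmonic polynomials and their Gaussian moments -/

section Harmonic

open MvPolynomial

variable {d : ℕ}

/-- The Laplacian on real polynomials. -/
def polyLaplacian : MvPolynomial (Fin d) ℝ →ₗ[ℝ] MvPolynomial (Fin d) ℝ :=
  ∑ i, (pderiv i).toLinearMap ∘ₗ (pderiv i).toLinearMap

lemma polyLaplacian_apply (p : MvPolynomial (Fin d) ℝ) :
    polyLaplacian p = ∑ i, pderiv i (pderiv i p) := by
  simp [polyLaplacian]

lemma pderiv_pderiv_comm (i j : Fin d) (p : MvPolynomial (Fin d) ℝ) :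
    pderiv i (pderiv j p) = pderiv j (pderiv i p) := by
  have h : ⁅(pderiv i : Derivation ℝ (MvPolynomial (Fin d) ℝ) (MvPolynomial (Fin d) ℝ)),
      (pderiv j : Derivation ℝ (MvPolynomial (Fin d) ℝ) (MvPolynomial (Fin d) ℝ))⁆ = 0 := by
    refine MvPolynomial.derivation_ext fun k => ?_
    simp only [Derivation.commutator_apply, pderiv_X, Derivation.zero_apply]
    by_cases h1 : j = k <;> by_cases h2 : i = k <;> simp [h1, h2]
  have := congrArg (fun D => D p) h
  simpa [Derivation.commutator_apply, sub_eq_zero] using this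

lemma polyLaplacian_pderiv (i : Fin d) (p : MvPolynomial (Fin d) ℝ) :
    polyLaplacian (pderiv i p) = pderiv i (polyLaplacian p) := by
  simp only [polyLaplacian_apply, map_sum]
  refine Finset.sum_congr rfl fun j _ => ?_
  rw [pderiv_pderiv_comm j i, pderiv_pderiv_comm j i]

/-- The space of harmonic homogeneous polynomials of degree `n`. -/
def harmonicPoly (d n : ℕ) : Submodule ℝ (MvPolynomial (Fin d) ℝ) :=
  homogeneousSubmodule (Fin d) ℝ n ⊓ LinearMap.ker polyLaplacian

lemma mem_harmonicPoly {n : ℕ} {p : MvPolynomial (Fin d) ℝ} :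
    p ∈ harmonicPoly d n ↔ p.IsHomogeneous n ∧ polyLaplacian p = 0 := Iff.rfl

lemma pderiv_mem_harmonicPoly {n : ℕ} {p : MvPolynomial (Fin d) ℝ} (hp : p ∈ harmonicPoly d n)
    (i : Fin d) : pderiv i p ∈ harmonicPoly d (n - 1) :=
  mem_harmonicPoly.2 ⟨hp.1.pderiv, by
    rw [polyLaplacian_pderiv, (mem_harmonicPoly.1 hp).2, map_zero]⟩

lemma pderiv_eq_zero_of_isHomogeneous_zero {p : MvPolynomial (Fin d) ℝ}
    (hp : p.IsHomogeneous 0) (i : Fin d) : pderiv i p = 0 := by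
  rw [← totalDegree_zero_iff_isHomogeneous, totalDegree_eq_zero_iff_eq_C] at hp
  rw [hp, pderiv_C]

/-- A harmonic homogeneous polynomial is orthogonal, in the Gaussian `L_2` space, to all
homogeneous polynomials of lower degree. -/
lemma gaussInt_mul_eq_zero {n : ℕ} {p : MvPolynomial (Fin d) ℝ} (hp : p ∈ harmonicPoly d n)
    {m : ℕ} (hmn : m < n) {g : MvPolynomial (Fin d) ℝ} (hg : g.IsHomogeneous m) :
    gaussInt (p * g) = 0 := by
  induction n generalizing p m g with
  | zero => omega
  | succ n ih =>
    -- Euler's identity turns `(n + 1) p` into `∑ i, X i * ∂ᵢ p`; integrating by parts then leaves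
    -- only the products `∂ᵢ p * ∂ᵢ g`, since `p` is harmonic
    have hE : ((n + 1 : ℕ) : ℝ) * gaussInt (p * g) =
        ∑ i, gaussInt (pderiv i p * pderiv i g) := by
      rw [← gaussInt_C_mul, ← mul_assoc]
      have h1 : C ((n + 1 : ℕ) : ℝ) * p = ∑ i, X i * pderiv i p := by
        rw [hp.1.sum_X_mul_pderiv, nsmul_eq_mul, map_natCast]
      rw [h1, Finset.sum_mul, map_sum]
      simp only [mul_assoc, gaussInt_X_mul, pderiv_mul, map_add, Finset.sum_add_distrib]
      rw [← map_sum, ← Finset.sum_mul, ← polyLaplacian_apply, (mem_harmonicPoly.1 hp).2]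
      simp
    have h0 : ∀ i, gaussInt (pderiv i p * pderiv i g) = 0 := by
      intro i
      rcases Nat.eq_zero_or_pos m with rfl | hm
      · rw [pderiv_eq_zero_of_isHomogeneous_zero hg, mul_zero, map_zero]
      · exact ih (pderiv_mem_harmonicPoly hp i) (by omega) hg.pderiv
    rw [Finset.sum_eq_zero fun i _ => h0 i] at hE
    exact (mul_eq_zero.1 hE).resolve_left (by positivity)

/-- The linear form `y ↦ x·y`. -/
def linForm (x : E d) : MvPolynomial (Fin d) ℝ := ∑ i, C (x i) * X i

lemma polyFun_linForm (x y : E d) : polyFun (linForm x) y = inner ℝ x y := by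
  simp [linForm, PiLp.inner_apply, mul_comm]

lemma isHomogeneous_linForm (x : E d) : (linForm x).IsHomogeneous 1 :=
  IsHomogeneous.sum _ _ _ fun _ _ => isHomogeneous_C_mul_X _ _

lemma pderiv_linForm (x : E d) (i : Fin d) : pderiv i (linForm x) = C (x i) := by
  simp only [linForm, map_sum, pderiv_C_mul]
  rw [Finset.sum_eq_single i]
  · simp
  · intro j _ hj
    simp [pderiv_X_of_ne hj]
  · simp

/-- The derivative of a polynomial in the direction `x`. -/
def dirDeriv (x : E d) (p : MvPolynomial (Fin d) ℝ) : MvPolynomial (Fin d) ℝ :=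
  ∑ i, C (x i) * pderiv i p

lemma dirDeriv_mem_harmonicPoly {n : ℕ} {p : MvPolynomial (Fin d) ℝ}
    (hp : p ∈ harmonicPoly d n) (x : E d) : dirDeriv x p ∈ harmonicPoly d (n - 1) := by
  refine Submodule.sum_mem _ fun i _ => ?_
  rw [← smul_eq_C_mul]
  exact Submodule.smul_mem _ _ (pderiv_mem_harmonicPoly hp i)

lemma polyFun_dirDeriv_self {n : ℕ} {p : MvPolynomial (Fin d) ℝ} (hp : p.IsHomogeneous n)
    (x : E d) : polyFun (dirDeriv x p) x = n * polyFun p x := by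
  have := congrArg (fun q => polyFun q x) hp.sum_X_mul_pderiv
  simpa [dirDeriv] using this

/-- Splitting off one factor `x·y` and integrating by parts. For `m = 0` the first term vanishes,
whatever the truncated exponent `m - 1`. -/
lemma gaussInt_mul_linForm_pow (p : MvPolynomial (Fin d) ℝ) (x : E d) (m : ℕ) :
    gaussInt (p * linForm x ^ (m + 1)) =
      m * ‖x‖ ^ 2 * gaussInt (p * linForm x ^ (m - 1)) +
        gaussInt (dirDeriv x p * linForm x ^ m) := by
  have h1 : p * linForm x ^ (m + 1) = ∑ i, C (x i) * (X i * (p * linForm x ^ m)) := by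
    rw [pow_succ', linForm, Finset.sum_mul, Finset.mul_sum]
    exact Finset.sum_congr rfl fun i _ => by ring
  rw [h1, map_sum]
  simp only [gaussInt_C_mul, gaussInt_X_mul, pderiv_mul, pderiv_pow, pderiv_linForm, map_add,
    mul_add, Finset.sum_add_distrib]
  rw [add_comm]
  congr 1
  · have : ∀ i, gaussInt (p * ((m : MvPolynomial (Fin d) ℝ) * linForm x ^ (m - 1) * C (x i))) =
        m * x i * gaussInt (p * linForm x ^ (m - 1)) := by
      intro i
      rw [← gaussInt_C_mul]
      congr 1
      simp only [map_mul, map_natCast]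
      ring
    simp only [this]
    rw [EuclideanSpace.real_norm_sq_eq, Finset.mul_sum, Finset.sum_mul]
    exact Finset.sum_congr rfl fun i _ => by ring
  · simp only [← gaussInt_C_mul, ← map_sum, dirDeriv, Finset.sum_mul, mul_assoc]

/-- The Gaussian moments `∫ p(y) (x·y)^m exp(-|y|²/2) dy` of a harmonic homogeneous polynomial,
from the recursion `gaussInt_mul_linForm_pow`. Both of its terms stay among such moments, since
directional derivatives of harmonic polynomials are harmonic. -/
lemma gaussInt_harmonic_mul_linForm_pow {n : ℕ} {p : MvPolynomial (Fin d) ℝ}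
    (hp : p ∈ harmonicPoly d n) (x : E d) (m : ℕ) :
    (∀ k, m = n + 2 * k → gaussInt (p * linForm x ^ m) =
      m.factorial / (2 ^ k * k.factorial) * ‖x‖ ^ (2 * k) * polyFun p x *
        (2 * Real.pi) ^ ((d : ℝ) / 2)) ∧
    ((∀ k, m ≠ n + 2 * k) → gaussInt (p * linForm x ^ m) = 0) := by
  induction m using Nat.strong_induction_on generalizing n p with
  | _ m ih =>
  rcases m with _ | m
  · refine ⟨fun k hk => ?_, fun h => ?_⟩
    · obtain ⟨rfl, rfl⟩ : n = 0 ∧ k = 0 := by omega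
      have h0 := (mem_harmonicPoly.1 hp).1
      rw [← totalDegree_zero_iff_isHomogeneous,
        totalDegree_eq_zero_iff_eq_C] at h0
      rw [h0, gaussInt_C_mul, pow_zero, gaussInt_one]
      simp
    · have hn : 0 < n := Nat.pos_of_ne_zero fun h0 => h 0 (by omega)
      exact gaussInt_mul_eq_zero hp hn (by simpa using isHomogeneous_one (Fin d) ℝ)
  · rw [gaussInt_mul_linForm_pow]
    have hD : n = 0 → dirDeriv x p = 0 := by
      rintro rfl
      exact Finset.sum_eq_zero fun _ _ => by
        rw [pderiv_eq_zero_of_isHomogeneous_zero hp.1, mul_zero]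
    have ihD := ih m (by omega) (dirDeriv_mem_harmonicPoly hp x)
    refine ⟨fun k hk => ?_, fun h => ?_⟩
    · have e2 : gaussInt (dirDeriv x p * linForm x ^ m) =
          n * (m.factorial / (2 ^ k * k.factorial) * ‖x‖ ^ (2 * k) * polyFun p x *
            (2 * Real.pi) ^ ((d : ℝ) / 2)) := by
        rcases Nat.eq_zero_or_pos n with h0 | h0
        · simp [hD h0, h0]
        · rw [ihD.1 k (by omega), polyFun_dirDeriv_self hp.1]
          ring
      have e1 : m * ‖x‖ ^ 2 * gaussInt (p * linForm x ^ (m - 1)) =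
          2 * k * (m.factorial / (2 ^ k * k.factorial) * ‖x‖ ^ (2 * k) * polyFun p x *
            (2 * Real.pi) ^ ((d : ℝ) / 2)) := by
        rcases k with _ | k
        · rcases m with _ | m
          · simp
          · rw [(ih (m + 1 - 1) (by omega) hp).2 (by omega)]
            simp
        · obtain ⟨m, rfl⟩ : ∃ m', m = m' + 1 := ⟨n + 2 * k, by omega⟩
          rw [(ih (m + 1 - 1) (by omega) hp).1 k (by omega), Nat.add_sub_cancel,
            Nat.factorial_succ, Nat.factorial_succ]
          push_cast
          field_simp
          ring
      rw [e1, e2, Nat.factorial_succ]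
      have : ((m + 1 : ℕ) : ℝ) = n + 2 * k := by rw [hk]; push_cast; ring
      rw [Nat.cast_mul, this]
      ring
    · have e2 : gaussInt (dirDeriv x p * linForm x ^ m) = 0 := by
        rcases Nat.eq_zero_or_pos n with h0 | h0
        · simp [hD h0]
        · exact ihD.2 fun k hk => h k (by omega)
      rw [e2, add_zero]
      rcases m with _ | m
      · simp
      · rw [(ih (m + 1 - 1) (by omega) hp).2 fun k hk => h (k + 1) (by omega), mul_zero]

end Harmonic

/-! ### Polar coordinates and integrals over the sphere -/

section Polar

variable {d : ℕ} {F : Type*} [NormedAddCommGroup F] [NormedSpace ℝ F]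

/-- Integration in polar coordinates. -/
lemma integral_polar (hd : 0 < d) {f : E d → F} (hf : Integrable f) :
    ∫ x, f x = ∫ r in Set.Ioi (0 : ℝ), r ^ (d - 1) • ∫ η : S d, f (r • (η : E d)) ∂(surf d) := by
  have : Nonempty (Fin d) := ⟨⟨0, hd⟩⟩
  have hmp := (volume : Measure (E d)).measurePreserving_homeomorphUnitSphereProd
  have hemb := (homeomorphUnitSphereProd (E d)).measurableEmbedding
  set g : S d × Set.Ioi (0 : ℝ) → F := fun z => f (z.2.1 • (z.1 : E d)) with hg
  have hgf : ∀ x : ({0}ᶜ : Set (E d)), g (homeomorphUnitSphereProd (E d) x) = f x := by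
    intro x
    have hx : ‖(x : E d)‖ ≠ 0 := norm_ne_zero_iff.2 x.2
    simp [hg, smul_smul, hx]
  have hgi : Integrable g ((surf d).prod (Measure.volumeIoiPow (d - 1))) := by
    have h1 := hmp.integrable_comp_emb (g := g) hemb
    rw [finrank_euclideanSpace_fin] at h1
    rw [← h1]
    have h2 : IntegrableOn f ({0}ᶜ : Set (E d)) := hf.integrableOn
    rw [integrableOn_iff_comap_subtypeVal (by measurability)] at h2
    exact h2.congr (ae_of_all _ fun x => (hgf x).symm)
  calc ∫ x, f x = ∫ x : ({0}ᶜ : Set (E d)), f x ∂(volume.comap Subtype.val) := by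
        rw [integral_subtype_comap (measurableSet_singleton _).compl f,
          restrict_compl_singleton]
    _ = ∫ z, g z ∂((surf d).prod (Measure.volumeIoiPow (d - 1))) := by
        have h1 := hmp.integral_comp hemb g
        rw [finrank_euclideanSpace_fin] at h1
        rw [← h1]
        exact integral_congr_ae (ae_of_all _ fun x => (hgf x).symm)
    _ = ∫ r : Set.Ioi (0 : ℝ), (∫ η : S d, f (r.1 • (η : E d)) ∂(surf d))
          ∂(Measure.volumeIoiPow (d - 1)) := integral_prod_symm _ hgi
    _ = _ := by
        rw [Measure.volumeIoiPow]
        simp only [ENNReal.ofReal]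
        rw [integral_withDensity_eq_integral_smul, integral_subtype_comap measurableSet_Ioi
          (fun r : ℝ => Real.toNNReal (r ^ (d - 1)) • ∫ η : S d, f (r • (η : E d)) ∂(surf d))]
        · refine setIntegral_congr_fun measurableSet_Ioi fun r hr => ?_
          simp only [NNReal.smul_def]
          rw [Real.coe_toNNReal _ (pow_nonneg (le_of_lt hr) _)]
        · fun_prop

open MvPolynomial

/-- The integral of a polynomial over the unit sphere. -/
def sphereInt {d : ℕ} (p : MvPolynomial (Fin d) ℝ) : ℝ := ∫ ξ : S d, polyFun p ξ ∂(surf d)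

/-- The value `2^(s/2-1) Γ(s/2)` of the integral `∫₀^∞ r^(s-1) exp(-r²/2) dr`. -/
def gaussRadial (s : ℝ) : ℝ := (1 / 2 : ℝ) ^ (-s / 2) * (1 / 2) * Real.Gamma (s / 2)

lemma gaussRadial_pos {s : ℝ} (hs : 0 < s) : 0 < gaussRadial s := by
  have := Real.Gamma_pos_of_pos (half_pos hs)
  unfold gaussRadial
  positivity

lemma gaussInt_eq_gaussRadial_mul_sphereInt (hd : 0 < d) {N : ℕ} {p : MvPolynomial (Fin d) ℝ}
    (hp : p.IsHomogeneous N) : gaussInt p = gaussRadial (N + d) * sphereInt p := by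
  have hd1 : (1 : ℝ) ≤ d := by exact_mod_cast hd
  have hN : (0 : ℝ) ≤ N := by positivity
  rw [gaussInt_apply, integral_polar hd (integrable_polyFun_mul_gaussWeight p)]
  have h := integral_rpow_mul_exp_neg_mul_rpow (p := 2) (q := N + d - 1) (b := 1 / 2) two_pos
    (by linarith) (by norm_num)
  rw [show -((N : ℝ) + d - 1 + 1) / 2 = -(N + d) / 2 by ring,
    show ((N : ℝ) + d - 1 + 1) / 2 = (N + d) / 2 by ring] at h
  rw [gaussRadial, ← h, ← integral_mul_const]
  refine setIntegral_congr_fun measurableSet_Ioi fun r hr => ?_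
  have hr0 : (0 : ℝ) < r := hr
  have h1 : ∀ η : S d, gaussWeight (r • (η : E d)) = Real.exp (-(1 / 2) * r ^ (2 : ℝ)) := by
    intro η
    simp [gaussWeight, norm_smul]
  simp only [polyFun_homogeneous p _ hp, h1, smul_eq_mul, sphereInt]
  rw [integral_mul_const, integral_const_mul]
  have h2 : r ^ ((N : ℝ) + d - 1) = r ^ (d - 1) * r ^ N := by
    rw [← pow_add, ← Real.rpow_natCast]
    congr 1
    push_cast [Nat.cast_sub hd]
    ring
  rw [h2]
  ring

lemma continuous_polyFun_sphere (p : MvPolynomial (Fin d) ℝ) :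
    Continuous fun ξ : S d => polyFun p (ξ : E d) :=
  (continuous_polyFun p).comp continuous_subtype_val

/-- On the sphere, a harmonic homogeneous polynomial is orthogonal to all homogeneous
polynomials of lower degree. -/
lemma sphereInt_mul_eq_zero (hd : 0 < d) {n m : ℕ} (hmn : m < n) {p g : MvPolynomial (Fin d) ℝ}
    (hp : p ∈ harmonicPoly d n) (hg : g.IsHomogeneous m) : sphereInt (p * g) = 0 := by
  have h := gaussInt_mul_eq_zero hp hmn hg
  rw [gaussInt_eq_gaussRadial_mul_sphereInt hd (hp.1.mul hg)] at h
  refine (mul_eq_zero.1 h).resolve_left (gaussRadial_pos ?_).ne'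
  have : (0 : ℝ) < d := by exact_mod_cast hd
  positivity

lemma sphereInt_harmonic_mul_eq_zero (hd : 0 < d) {n m : ℕ} (hmn : m ≠ n)
    {p q : MvPolynomial (Fin d) ℝ} (hp : p ∈ harmonicPoly d n) (hq : q ∈ harmonicPoly d m) :
    sphereInt (p * q) = 0 := by
  rcases hmn.lt_or_gt with h | h
  · exact sphereInt_mul_eq_zero hd h hp hq.1
  · rw [mul_comm]
    exact sphereInt_mul_eq_zero hd h hq hp.1

/-- The moments `∫ p(ξ) (x·ξ)^m dS(ξ)` of a spherical harmonic, which carry the coefficients of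
the Bessel function of order `n + (d - 2) / 2`. -/
lemma sphereInt_harmonic_mul_linForm_pow (hd : 0 < d) {n : ℕ} {p : MvPolynomial (Fin d) ℝ}
    (hp : p ∈ harmonicPoly d n) (x : E d) (k : ℕ) :
    sphereInt (p * linForm x ^ (n + 2 * k)) / (n + 2 * k).factorial =
      (2 * Real.pi) ^ ((d : ℝ) / 2) * ((1 / 2 : ℝ) ^ (2 * k + (n + ((d : ℝ) - 2) / 2)) /
        (k.factorial * Real.Gamma (k + (n + ((d : ℝ) - 2) / 2) + 1))) *
          (‖x‖ ^ (2 * k) * polyFun p x) := by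
  have hd0 : (0 : ℝ) < d := by exact_mod_cast hd
  have h := (gaussInt_harmonic_mul_linForm_pow hp x (n + 2 * k)).1 k rfl
  rw [gaussInt_eq_gaussRadial_mul_sphereInt hd
    (hp.1.mul ((isHomogeneous_linForm x).pow (n + 2 * k)))] at h
  have hs : (0 : ℝ) < ((n + 1 * (n + 2 * k) : ℕ) : ℝ) + d := by positivity
  have hG := Real.Gamma_pos_of_pos (half_pos hs)
  rw [gaussRadial] at h
  have e1 : (((n + 1 * (n + 2 * k) : ℕ) : ℝ) + d) / 2 = k + (n + ((d : ℝ) - 2) / 2) + 1 := by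
    push_cast; ring
  have e2 : (1 / 2 : ℝ) ^ (2 * k + (n + ((d : ℝ) - 2) / 2)) =
      2 * (1 / 2) ^ k * (1 / 2 : ℝ) ^ ((((n + 1 * (n + 2 * k) : ℕ) : ℝ) + d) / 2) := by
    rw [e1, show (2 * k + (n + ((d : ℝ) - 2) / 2)) =
      (k + (n + ((d : ℝ) - 2) / 2) + 1) + (k : ℝ) + (-1 : ℝ) by ring,
      Real.rpow_add (by norm_num), Real.rpow_add (by norm_num), Real.rpow_natCast,
      Real.rpow_neg_one]
    ring
  rw [e2, ← e1]
  rw [neg_div, Real.rpow_neg (by norm_num)] at h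
  have hP : (0 : ℝ) < (1 / 2 : ℝ) ^ ((((n + 1 * (n + 2 * k) : ℕ) : ℝ) + d) / 2) := by positivity
  generalize (1 / 2 : ℝ) ^ ((((n + 1 * (n + 2 * k) : ℕ) : ℝ) + d) / 2) = P at *
  generalize Real.Gamma ((((n + 1 * (n + 2 * k) : ℕ) : ℝ) + d) / 2) = G at *
  generalize sphereInt (p * linForm x ^ (n + 2 * k)) = σ at *
  have hσ : σ = (2 * P / G) * (P⁻¹ * (1 / 2) * G * σ) := by field_simp
  rw [hσ, h]
  have : ((n + 2 * k).factorial : ℝ) ≠ 0 := by positivity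
  rw [div_pow, one_pow]
  field_simp

lemma sphereInt_harmonic_mul_linForm_pow_eq_zero (hd : 0 < d) {n : ℕ}
    {p : MvPolynomial (Fin d) ℝ} (hp : p ∈ harmonicPoly d n) (x : E d) {m : ℕ}
    (hm : ∀ k, m ≠ n + 2 * k) : sphereInt (p * linForm x ^ m) = 0 := by
  have h := (gaussInt_harmonic_mul_linForm_pow hp x m).2 hm
  rw [gaussInt_eq_gaussRadial_mul_sphereInt hd
    (hp.1.mul ((isHomogeneous_linForm x).pow m))] at h
  refine (mul_eq_zero.1 h).resolve_left (gaussRadial_pos ?_).ne'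
  have : (0 : ℝ) < d := by exact_mod_cast hd
  positivity

end Polar

/-! ### Decomposition into harmonics and dimension -/

section Decomposition

open MvPolynomial

variable {d : ℕ}

/-- The polynomial `|x|²`. -/
def normSqPoly (d : ℕ) : MvPolynomial (Fin d) ℝ := ∑ i, X i ^ 2

lemma polyFun_normSqPoly (x : E d) : polyFun (normSqPoly d) x = ‖x‖ ^ 2 := by
  simp [normSqPoly, EuclideanSpace.real_norm_sq_eq]

lemma isHomogeneous_normSqPoly : (normSqPoly d).IsHomogeneous 2 :=
  IsHomogeneous.sum _ _ _ fun i _ => isHomogeneous_X_pow i 2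

lemma eq_zero_of_polyFun_eq_zero {p : MvPolynomial (Fin d) ℝ} (h : ∀ x : E d, polyFun p x = 0) :
    p = 0 := by
  refine MvPolynomial.funext fun x => ?_
  simpa [polyFun] using h (WithLp.toLp 2 x)

lemma eq_zero_of_gaussInt_mul_self {p : MvPolynomial (Fin d) ℝ} (h : gaussInt (p * p) = 0) :
    p = 0 := by
  have hpos : ∀ x : E d, 0 < gaussWeight x := fun x => Real.exp_pos _
  have hc : Continuous fun x : E d => polyFun (p * p) x * gaussWeight x :=
    (continuous_polyFun _).mul (by unfold gaussWeight; fun_prop)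
  rw [gaussInt_apply, integral_eq_zero_iff_of_nonneg
    (fun x => mul_nonneg (by rw [polyFun_mul]; exact mul_self_nonneg _) (hpos x).le)
    (integrable_polyFun_mul_gaussWeight _)] at h
  replace h := (hc.ae_eq_iff_eq _ continuous_zero).1 h
  refine eq_zero_of_polyFun_eq_zero fun x => ?_
  have := congrFun h x
  simpa [(hpos x).ne'] using this

/-- A harmonic homogeneous polynomial divisible by `|x|²` vanishes: on the sphere it agrees with
the quotient, to which it is orthogonal since the quotient has lower degree. -/
lemma eq_zero_of_normSqPoly_mul_mem_harmonicPoly (hd : 0 < d) {n : ℕ}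
    {q : MvPolynomial (Fin d) ℝ} (hq : q.IsHomogeneous n)
    (h : normSqPoly d * q ∈ harmonicPoly d (n + 2)) : q = 0 := by
  have h1 : sphereInt ((normSqPoly d * q) * (normSqPoly d * q)) = 0 := by
    rw [← sphereInt_mul_eq_zero hd (show n < n + 2 by omega) h hq]
    refine integral_congr_ae (ae_of_all _ fun ξ => ?_)
    simp [polyFun_normSqPoly]
  have h2 : normSqPoly d * q = 0 := by
    apply eq_zero_of_gaussInt_mul_self
    rw [gaussInt_eq_gaussRadial_mul_sphereInt hd (h.1.mul h.1), h1, mul_zero]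
  have h3 : normSqPoly d ≠ 0 := by
    intro h0
    have := polyFun_normSqPoly (EuclideanSpace.single (⟨0, hd⟩ : Fin d) (1 : ℝ))
    rw [h0] at this
    simp at this
  exact (mul_eq_zero.1 h2).resolve_left h3

lemma isHomogeneous_polyLaplacian {n : ℕ} {p : MvPolynomial (Fin d) ℝ}
    (hp : p.IsHomogeneous (n + 2)) : (polyLaplacian p).IsHomogeneous n := by
  rw [polyLaplacian_apply]
  exact IsHomogeneous.sum _ _ _ fun i _ => hp.pderiv.pderiv

lemma polyLaplacian_eq_zero_of_lt_two {n : ℕ} (hn : n < 2) {p : MvPolynomial (Fin d) ℝ}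
    (hp : p.IsHomogeneous n) : polyLaplacian p = 0 := by
  rw [polyLaplacian_apply]
  refine Finset.sum_eq_zero fun i _ => pderiv_eq_zero_of_isHomogeneous_zero ?_ i
  have := hp.pderiv (i := i)
  rwa [show n - 1 = 0 by omega] at this

instance finiteDimensional_homogeneousSubmodule (n : ℕ) :
    FiniteDimensional ℝ (homogeneousSubmodule (Fin d) ℝ n) :=
  Module.Finite.iff_fg.2 (homogeneousSubmodule_fg (Fin d) ℝ n)

instance finiteDimensional_harmonicPoly (n : ℕ) : FiniteDimensional ℝ (harmonicPoly d n) :=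
  Submodule.finiteDimensional_of_le inf_le_left

/-- The Laplacian of `|x|² q`, as an endomorphism of the space of homogeneous polynomials of
degree `n`. -/
def laplacianNormSq (d n : ℕ) :
    homogeneousSubmodule (Fin d) ℝ n →ₗ[ℝ] homogeneousSubmodule (Fin d) ℝ n :=
  (polyLaplacian ∘ₗ LinearMap.mulLeft ℝ (normSqPoly d)).restrict fun q hq => by
    have := isHomogeneous_normSqPoly.mul ((mem_homogeneousSubmodule n q).1 hq)
    exact isHomogeneous_polyLaplacian (by rwa [add_comm] at this)

lemma laplacianNormSq_apply {n : ℕ} (q : homogeneousSubmodule (Fin d) ℝ n) :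
    (laplacianNormSq d n q : MvPolynomial (Fin d) ℝ) =
      polyLaplacian (normSqPoly d * (q : MvPolynomial (Fin d) ℝ)) := rfl

lemma laplacianNormSq_surjective (hd : 0 < d) (n : ℕ) :
    Function.Surjective (laplacianNormSq d n) := by
  rw [← LinearMap.injective_iff_surjective, injective_iff_map_eq_zero]
  intro q hq
  have h := congrArg Subtype.val hq
  rw [laplacianNormSq_apply] at h
  refine Subtype.ext (eq_zero_of_normSqPoly_mul_mem_harmonicPoly hd q.2
    (mem_harmonicPoly.2 ⟨?_, h⟩))
  rw [add_comm]
  exact isHomogeneous_normSqPoly.mul q.2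

/-- Every homogeneous polynomial is a harmonic one plus a multiple of `|x|²`. -/
lemma exists_sub_normSqPoly_mul_mem_harmonicPoly (hd : 0 < d) {n : ℕ}
    {p : MvPolynomial (Fin d) ℝ} (hp : p.IsHomogeneous (n + 2)) :
    ∃ q : MvPolynomial (Fin d) ℝ, q.IsHomogeneous n ∧
      p - normSqPoly d * q ∈ harmonicPoly d (n + 2) := by
  obtain ⟨q, hq⟩ := laplacianNormSq_surjective hd n ⟨_, isHomogeneous_polyLaplacian hp⟩
  refine ⟨q, q.2, mem_harmonicPoly.2 ⟨hp.sub ?_, ?_⟩⟩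
  · rw [add_comm]
    exact isHomogeneous_normSqPoly.mul q.2
  · rw [map_sub, ← laplacianNormSq_apply, hq, sub_self]

lemma finrank_homogeneousSubmodule (d n : ℕ) :
    Module.finrank ℝ (homogeneousSubmodule (Fin d) ℝ n) = d.multichoose n := by
  have h : homogeneousSubmodule (Fin d) ℝ n =
      restrictSupport ℝ {m : Fin d →₀ ℕ | m.degree = n} :=
    homogeneousSubmodule_eq_finsupp_supported _ _ _
  have hs : {m : Fin d →₀ ℕ | m.degree = n} =
      ((Finset.univ : Finset (Fin d)).finsuppAntidiag n : Set (Fin d →₀ ℕ)) := by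
    ext m
    simp [Finset.mem_finsuppAntidiag, Finsupp.degree_eq_sum]
  rw [h, Module.finrank_eq_nat_card_basis (basisRestrictSupport ℝ _), hs, Nat.card_coe_set_eq,
    Set.ncard_coe_finset, Finset.card_finsuppAntidiag_nat_eq_multichoose, Finset.card_univ,
    Fintype.card_fin]

/-- The Laplacian maps homogeneous polynomials of degree `n + 2` onto those of degree `n`, and its
kernel consists of the harmonic ones. -/
lemma finrank_harmonicPoly_add (hd : 0 < d) (n : ℕ) :
    Module.finrank ℝ (harmonicPoly d (n + 2)) + d.multichoose n = d.multichoose (n + 2) := by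
  let f : homogeneousSubmodule (Fin d) ℝ (n + 2) →ₗ[ℝ] homogeneousSubmodule (Fin d) ℝ n :=
    polyLaplacian.restrict fun p hp => isHomogeneous_polyLaplacian hp
  have hf : Function.Surjective f := by
    intro p
    obtain ⟨q, hq⟩ := laplacianNormSq_surjective hd n p
    refine ⟨⟨normSqPoly d * q, ?_⟩, hq⟩
    rw [mem_homogeneousSubmodule, add_comm]
    exact isHomogeneous_normSqPoly.mul q.2
  have hk : (LinearMap.ker f).map (homogeneousSubmodule (Fin d) ℝ (n + 2)).subtype =
      harmonicPoly d (n + 2) := by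
    ext p
    constructor
    · rintro ⟨q, hq, rfl⟩
      exact ⟨q.2, congrArg Subtype.val hq⟩
    · intro hp
      exact ⟨⟨p, hp.1⟩, Subtype.ext hp.2, rfl⟩
  have h := f.finrank_range_add_finrank_ker
  rw [LinearMap.range_eq_top.2 hf, finrank_top, finrank_homogeneousSubmodule,
    finrank_homogeneousSubmodule] at h
  rw [← hk, Submodule.finrank_map_subtype_eq, add_comm, h]

/-- The dimension formula with cleared denominators, in dimension `D + 2` and degree `n + 1`. -/
lemma finrank_harmonicPoly_mul (D n : ℕ) :
    Module.finrank ℝ (harmonicPoly (D + 2) (n + 1)) * ((n + 1).factorial * D.factorial) =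
      (2 * (n + 1) + D) * (n + D).factorial := by
  rcases n with _ | m
  · have h : harmonicPoly (D + 2) 1 = homogeneousSubmodule (Fin (D + 2)) ℝ 1 :=
      inf_eq_left.2 fun p hp => polyLaplacian_eq_zero_of_lt_two one_lt_two hp
    rw [zero_add, h, finrank_homogeneousSubmodule, Nat.multichoose_one_right]
    simp only [zero_add, Nat.factorial_one]
    ring
  · have h := finrank_harmonicPoly_add (show 0 < D + 2 by omega) m
    have hA : (D + 2).multichoose (m + 2) * ((m + 2).factorial * (D + 1).factorial) =
        (D + m + 3).factorial := by
      rw [Nat.multichoose_eq, ← Nat.choose_mul_factorial_mul_factorial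
        (show m + 2 ≤ D + m + 3 by omega), mul_assoc]
      congr 3 <;> omega
    have hB : (D + 2).multichoose m * (m.factorial * (D + 1).factorial) =
        (D + m + 1).factorial := by
      rw [Nat.multichoose_eq, ← Nat.choose_mul_factorial_mul_factorial
        (show m ≤ D + m + 1 by omega), mul_assoc]
      congr 3 <;> omega
    rw [← h] at hA
    simp only [Nat.factorial_succ, Nat.add_assoc, Nat.reduceAdd] at hA hB ⊢
    rw [show m + (1 + D) = D + (m + 1) by ring]
    have hF : (D + (m + 1)).factorial = (D + (m + 1)) * (D + m).factorial :=
      Nat.factorial_succ (D + m)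
    have hF2 : (D + (m + 2)).factorial = (D + (m + 2)) * (D + (m + 1)).factorial :=
      Nat.factorial_succ (D + (m + 1))
    have hF3 : (D + (m + 3)).factorial = (D + (m + 3)) * (D + (m + 2)).factorial :=
      Nat.factorial_succ (D + (m + 2))
    rw [hF3, hF2, ← hB] at hA
    rw [← hB]
    refine Nat.eq_of_mul_eq_mul_left (Nat.succ_pos D) ?_
    zify at hA hB ⊢
    linear_combination hA

/-- The dimension of the space of harmonic homogeneous polynomials of degree `n`. -/
lemma finrank_harmonicPoly (hd : 2 ≤ d) (n : ℕ) :
    Module.finrank ℝ (harmonicPoly d n) = harmonicDim d n := by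
  obtain ⟨D, rfl⟩ := Nat.exists_eq_add_of_le' hd
  rcases n with _ | n
  · have h : harmonicPoly (D + 2) 0 = homogeneousSubmodule (Fin (D + 2)) ℝ 0 :=
      inf_eq_left.2 fun p hp => polyLaplacian_eq_zero_of_lt_two two_pos hp
    rw [h, finrank_homogeneousSubmodule, Nat.multichoose_zero_right, harmonicDim, if_pos rfl]
  · rw [harmonicDim, if_neg n.succ_ne_zero]
    refine (Nat.div_eq_of_eq_mul_left (by positivity) ?_).symm
    rw [show n + 1 + (D + 2) - 3 = n + D by omega, Nat.add_sub_cancel,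
      show 2 * (n + 1) + (D + 2) - 2 = 2 * (n + 1) + D by omega, finrank_harmonicPoly_mul]

lemma harmonicDim_pos (hd : 2 ≤ d) (n : ℕ) : 0 < harmonicDim d n := by
  rw [← finrank_harmonicPoly hd]
  obtain ⟨D, rfl⟩ := Nat.exists_eq_add_of_le' hd
  rcases n with _ | n
  · rw [finrank_harmonicPoly hd, harmonicDim, if_pos rfl]
    exact one_pos
  · have h := finrank_harmonicPoly_mul D n
    have : 0 < (2 * (n + 1) + D) * (n + D).factorial := by positivity
    rw [← h] at this
    exact pos_of_mul_pos_left this (Nat.zero_le _)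

end Decomposition

/-! ### Spherical harmonics in `L_2` of the sphere -/

section SphereL2

open MvPolynomial

variable {d : ℕ}

/-- The restriction to the unit sphere of the polynomial function of a real polynomial. -/
def polySphere (p : MvPolynomial (Fin d) ℝ) : C(S d, ℝ) :=
  ⟨fun ξ => polyFun p ξ, continuous_polyFun_sphere p⟩

@[simp] lemma polySphere_apply (p : MvPolynomial (Fin d) ℝ) (ξ : S d) :
    polySphere p ξ = polyFun p ξ := rfl

/-- The restriction to the unit sphere of a real polynomial, as an element of `L_2`. -/
def polyL2 : MvPolynomial (Fin d) ℝ →ₗ[ℝ] L2S d where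
  toFun p := toL2S d (polySphere p)
  map_add' p q := by
    simp only [toL2S, ← map_add]
    congr 1
    ext ξ
    simp
  map_smul' c p := by
    rw [RingHom.id_apply, RCLike.real_smul_eq_coe_smul (K := ℂ) c (toL2S d (polySphere p))]
    simp only [toL2S, ← map_smul]
    congr 1
    ext ξ
    simp

lemma polyL2_apply (p : MvPolynomial (Fin d) ℝ) : polyL2 p = toL2S d (polySphere p) := rfl

lemma polyL2_congr {p q : MvPolynomial (Fin d) ℝ} (h : ∀ ξ : S d, polyFun p ξ = polyFun q ξ) :
    polyL2 p = polyL2 q := by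
  rw [polyL2_apply, polyL2_apply]
  congr 1
  ext ξ
  exact h ξ

lemma inner_polyL2 (p q : MvPolynomial (Fin d) ℝ) :
    inner ℂ (polyL2 p) (polyL2 q) = (sphereInt (p * q) : ℂ) := by
  rw [polyL2_apply, polyL2_apply, toL2S, toL2S, ContinuousMap.inner_toLp, sphereInt,
    ← integral_complex_ofReal]
  congr 1
  ext ξ
  simp [mul_comm]

/-- The expansion of plane waves on the sphere into powers of linear forms. -/
lemma hasSum_planeWave (x : E d) :
    HasSum (fun m : ℕ => ((m.factorial : ℂ)⁻¹ * (-Complex.I) ^ m) • polyL2 (linForm x ^ m))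
      (ContinuousMap.toLp 2 (surf d) ℂ (planeWave d x)) := by
  let f : C(S d, ℂ) := ⟨fun ξ => -(Complex.I * ((inner ℝ x (ξ : E d) : ℝ) : ℂ)), by fun_prop⟩
  have hf : NormedSpace.exp f = planeWave d x := by
    ext ξ
    have h1 := (NormedSpace.exp_series_hasSum_exp' (𝕂 := ℂ) f).mapL
      (ContinuousMap.evalCLM ℂ ξ : C(S d, ℂ) →L[ℂ] ℂ)
    have h2 := NormedSpace.exp_series_hasSum_exp' (𝕂 := ℂ) (f ξ)
    have h3 := h1.unique (by simpa using h2)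
    change NormedSpace.exp f ξ = Complex.exp (f ξ)
    rw [Complex.exp_eq_exp_ℂ]
    simpa using h3
  have h := (NormedSpace.exp_series_hasSum_exp' (𝕂 := ℂ) f).mapL
    (ContinuousMap.toLp 2 (surf d) ℂ : C(S d, ℂ) →L[ℂ] L2S d)
  rw [hf] at h
  refine h.congr_fun fun m => ?_
  rw [polyL2_apply, toL2S, ← map_smul]
  congr 1
  ext ξ
  have hξ : f ξ = -Complex.I * ((inner ℝ x (ξ : E d) : ℝ) : ℂ) := (neg_mul _ _).symm
  simp only [ContinuousMap.smul_apply, ContinuousMap.pow_apply, ContinuousMap.coe_mk, hξ, mul_pow,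
    polySphere_apply, polyFun_pow, polyFun_linForm, smul_eq_mul, Complex.ofReal_pow, mul_assoc]

lemma exists_mem_harmonicPoly_of_isSphericalHarmonic {n : ℕ} {f : C(S d, ℝ)}
    (hf : IsSphericalHarmonic d n f) : ∃ p ∈ harmonicPoly d n, f = polySphere p := by
  obtain ⟨p, hp, hl, h⟩ := hf
  exact ⟨p, mem_harmonicPoly.2 ⟨hp, by rw [polyLaplacian_apply, hl]⟩, ContinuousMap.ext h⟩

/-- The spherical harmonics of all degrees span every polynomial on the sphere. -/
lemma polyL2_mem_of_isHomogeneous (hd : 0 < d) {W : Submodule ℂ (L2S d)}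
    (hW : ∀ n, ∀ p ∈ harmonicPoly d n, polyL2 p ∈ W) {n : ℕ} {p : MvPolynomial (Fin d) ℝ}
    (hp : p.IsHomogeneous n) : polyL2 p ∈ W := by
  induction n using Nat.strong_induction_on generalizing p with
  | _ n ih =>
  rcases lt_or_ge n 2 with h2 | h2
  · exact hW n p (mem_harmonicPoly.2 ⟨hp, polyLaplacian_eq_zero_of_lt_two h2 hp⟩)
  · obtain ⟨m, rfl⟩ := Nat.exists_eq_add_of_le' h2
    obtain ⟨q, hq, hpq⟩ := exists_sub_normSqPoly_mul_mem_harmonicPoly hd hp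
    have h := W.add_mem (hW _ _ hpq) (ih m (by omega) hq)
    have h' : polyL2 q = polyL2 (normSqPoly d * q) :=
      polyL2_congr fun ξ => by simp [polyFun_normSqPoly]
    rwa [h', ← map_add, sub_add_cancel] at h

/-- The spherical harmonics are complete: a density orthogonal to all of them is orthogonal to the
powers of linear forms, hence to plane waves, so its Herglotz wave vanishes. -/
lemma eq_zero_of_orthogonal_harmonics (hd : 0 < d) {φ : L2S d}
    (h : ∀ n, ∀ p ∈ harmonicPoly d n, inner ℂ (polyL2 p) φ = 0) : φ = 0 := by
  apply herglotzMap_injective d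
  rw [map_zero]
  funext x
  have h1 : ∀ m : ℕ, inner ℂ φ (polyL2 (linForm x ^ m)) = 0 := by
    intro m
    have := polyL2_mem_of_isHomogeneous hd (W := (ℂ ∙ φ)ᗮ)
      (fun n p hp => (Submodule.mem_orthogonal_singleton_iff_inner_left).2 (h n p hp))
      ((isHomogeneous_linForm x).pow m)
    exact (Submodule.mem_orthogonal_singleton_iff_inner_right).1 this
  have h2 := (hasSum_planeWave x).mapL (innerSL ℂ φ)
  simp only [map_smul, innerSL_apply_apply, h1, smul_zero] at h2
  change herglotzWave d φ x = 0
  rw [herglotzWave_eq_inner, ← inner_conj_symm, h2.unique hasSum_zero, map_zero, mul_zero]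

variable {Y : (n : ℕ) → Fin (harmonicDim d n) → C(S d, ℝ)}

lemma orthonormal_toL2S (hd : 2 ≤ d) (hY : IsHarmonicSystem d Y) :
    Orthonormal ℂ fun p : (n : ℕ) × Fin (harmonicDim d n) => toL2S d (Y p.1 p.2) := by
  choose P hP hYP using fun n j =>
    exists_mem_harmonicPoly_of_isSphericalHarmonic ((hY n).1 j)
  classical
  rw [orthonormal_iff_ite]
  rintro ⟨n, j⟩ ⟨m, k⟩
  simp only [hYP, ← polyL2_apply, inner_polyL2]
  by_cases hnm : n = m
  · subst hnm
    have h := (hY n).2 j k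
    simp only [hYP] at h
    have h' : sphereInt (P n j * P n k) = if j = k then 1 else 0 := by
      rw [← h, sphereInt]
      simp
    rw [h']
    by_cases hjk : j = k <;> simp [hjk]
  · rw [sphereInt_harmonic_mul_eq_zero (by omega) (Ne.symm hnm) (hP n j) (hP m k), if_neg]
    · simp
    · exact fun h => hnm (congrArg Sigma.fst h)

/-- By the dimension formula, `N_{n,d}` orthonormal spherical harmonics of degree `n` span
all of them. -/
lemma polyL2_mem_span_of_mem_harmonicPoly (hd : 2 ≤ d) (hY : IsHarmonicSystem d Y) {n : ℕ}
    {p : MvPolynomial (Fin d) ℝ} (hp : p ∈ harmonicPoly d n) :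
    polyL2 p ∈ Submodule.span ℂ (Set.range fun j => toL2S d (Y n j)) := by
  choose P hP hYP using fun j => exists_mem_harmonicPoly_of_isSphericalHarmonic ((hY n).1 j)
  have hli : LinearIndependent ℂ fun j => toL2S d (Y n j) :=
    ((orthonormal_toL2S hd hY).comp (fun j => (⟨n, j⟩ : (n : ℕ) × Fin (harmonicDim d n)))
      fun _ _ h => eq_of_heq (Sigma.mk.inj h).2).linearIndependent
  let v : Fin (harmonicDim d n) → harmonicPoly d n := fun j => ⟨P j, hP j⟩
  have hv : LinearIndependent ℝ v := by
    refine LinearIndependent.of_comp (polyL2 ∘ₗ (harmonicPoly d n).subtype) ?_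
    have h : (polyL2 ∘ₗ (harmonicPoly d n).subtype) ∘ v = fun j => toL2S d (Y n j) := by
      ext1 j
      simp [v, polyL2_apply, hYP]
    rw [h]
    exact hli.restrict_scalars' ℝ
  have hs := hv.span_eq_top_of_card_eq_finrank' (by
    rw [Fintype.card_fin, finrank_harmonicPoly hd])
  have hmem : (⟨p, hp⟩ : harmonicPoly d n) ∈ Submodule.span ℝ (Set.range v) := by
    rw [hs]; trivial
  obtain ⟨c, hc⟩ := (Submodule.mem_span_range_iff_exists_fun ℝ).1 hmem
  have hc' : p = ∑ j, c j • P j := by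
    have := congrArg Subtype.val hc
    simpa [v] using this.symm
  rw [hc', map_sum]
  refine Submodule.sum_mem _ fun j _ => ?_
  rw [map_smul, RCLike.real_smul_eq_coe_smul (K := ℂ), polyL2_apply, ← hYP]
  exact Submodule.smul_mem _ _ (Submodule.subset_span ⟨j, rfl⟩)

lemma orthonormal_basisVec (hd : 2 ≤ d) (hY : IsHarmonicSystem d Y) :
    Orthonormal ℂ fun p : (n : ℕ) × Fin (harmonicDim d n) => basisVec d Y p.1 p.2 :=
  (orthonormal_toL2S hd hY).comp_linearIsometry (herglotzUnitary d).toLinearIsometry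

lemma orthogonal_finiteCombinations (hd : 2 ≤ d) (hY : IsHarmonicSystem d Y) :
    (finiteCombinations d Y)ᗮ = ⊥ := by
  rw [eq_bot_iff]
  intro u hu
  have h : (herglotzUnitary d).symm u = 0 := by
    refine eq_zero_of_orthogonal_harmonics (by omega) fun n p hp => ?_
    have hp' := polyL2_mem_span_of_mem_harmonicPoly hd hY hp
    have hle : Submodule.span ℂ (Set.range fun j => toL2S d (Y n j)) ≤
        (ℂ ∙ (herglotzUnitary d).symm u)ᗮ := by
      rw [Submodule.span_le]
      rintro _ ⟨j, rfl⟩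
      refine (Submodule.mem_orthogonal_singleton_iff_inner_left).2 ?_
      have h1 := (Submodule.mem_orthogonal _ u).1 hu (basisVec d Y n j)
        (Submodule.subset_span ⟨⟨n, j⟩, rfl⟩)
      rwa [← (herglotzUnitary d).inner_map_map, LinearIsometryEquiv.apply_symm_apply]
    exact (Submodule.mem_orthogonal_singleton_iff_inner_left).1 (hle hp')
  simpa using h

end SphereL2

/-! ### Herglotz waves of spherical harmonics and the Toeplitz form -/

section Wave

open MvPolynomial

variable {d : ℕ}

lemma herglotzConst_mul (d : ℕ) :
    herglotzConst d * (2 * Real.pi) ^ ((d : ℝ) / 2) = √Real.pi := by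
  have : (0 : ℝ) < (2 * Real.pi) ^ ((d : ℝ) / 2) := by positivity
  rw [herglotzConst]
  field_simp

lemma hasSum_herglotzWave_polyL2 (p : MvPolynomial (Fin d) ℝ) (x : E d) :
    HasSum (fun m : ℕ => (herglotzConst d : ℂ) * (Complex.I ^ m *
      ((sphereInt (p * linForm x ^ m) / m.factorial : ℝ) : ℂ))) (herglotzWave d (polyL2 p) x) := by
  rw [herglotzWave_eq_inner]
  refine HasSum.mul_left _ ?_
  have h := (hasSum_planeWave x).mapL (innerSL ℂ (polyL2 p))
  have h' := h.map (starRingEnd ℂ) Complex.continuous_conj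
  rw [innerSL_apply_apply, inner_conj_symm] at h'
  refine h'.congr_fun fun m => ?_
  rw [Function.comp_apply, innerSL_apply_apply, inner_smul_right, inner_polyL2]
  simp only [map_mul, map_inv₀, map_pow, map_neg, Complex.conj_I, neg_neg, Complex.conj_ofReal,
    map_natCast, Complex.ofReal_div, Complex.ofReal_natCast]
  ring

/-- The radial factor of the Herglotz wave of a spherical harmonic of degree `n`, apart from the
constant `√π i^n`. It is used for `r > 0` only. -/
def radialFactor (d n : ℕ) (r : ℝ) : ℝ :=
  r ^ (-(((d : ℝ) - 2) / 2)) * besselJ (n + ((d : ℝ) - 2) / 2) r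

/-- The Herglotz wave of a spherical harmonic, in polar coordinates. -/
lemma herglotzWave_polyL2_smul (hd : 0 < d) {n : ℕ} {p : MvPolynomial (Fin d) ℝ}
    (hp : p ∈ harmonicPoly d n) {r : ℝ} (hr : 0 < r) (η : S d) :
    herglotzWave d (polyL2 p) (r • (η : E d)) =
      (√Real.pi : ℂ) * Complex.I ^ n * radialFactor d n r * polyFun p η := by
  have h := hasSum_herglotzWave_polyL2 p (r • (η : E d))
  -- only the terms of index `n + 2 * k` of the exponential series survive
  have hinj : Function.Injective fun k : ℕ => n + 2 * k := fun a b hab => by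
    simp only at hab; omega
  rw [← hinj.hasSum_iff] at h
  swap
  · intro m hm
    rw [sphereInt_harmonic_mul_linForm_pow_eq_zero hd hp _ fun k hk => hm ⟨k, hk.symm⟩]
    simp
  have hterm : ∀ k : ℕ, (herglotzConst d : ℂ) * (Complex.I ^ (n + 2 * k) *
      ((sphereInt (p * linForm (r • (η : E d)) ^ (n + 2 * k)) / (n + 2 * k).factorial : ℝ) : ℂ)) =
      ((√Real.pi : ℂ) * Complex.I ^ n * ((r ^ (-(((d : ℝ) - 2) / 2)) : ℝ) : ℂ) * polyFun p η) *
        (((-1) ^ k / ((k.factorial : ℝ) * Real.Gamma (k + (n + ((d : ℝ) - 2) / 2) + 1)) *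
          (r / 2) ^ (2 * k + (n + ((d : ℝ) - 2) / 2)) : ℝ) : ℂ) := by
    intro k
    have hn : ‖r • (η : E d)‖ = r := by
      rw [norm_smul, norm_eq_of_mem_sphere, mul_one, Real.norm_of_nonneg hr.le]
    have hpow : r ^ (-(((d : ℝ) - 2) / 2)) * (r / 2) ^ (2 * k + (n + ((d : ℝ) - 2) / 2)) =
        (1 / 2 : ℝ) ^ (2 * k + (n + ((d : ℝ) - 2) / 2)) * (r ^ (2 * k) * r ^ n) := by
      rw [div_eq_mul_one_div r 2, Real.mul_rpow hr.le (by norm_num), ← mul_assoc,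
        ← Real.rpow_add hr, ← pow_add, mul_comm, ← Real.rpow_natCast]
      congr 2
      push_cast
      ring
    rw [sphereInt_harmonic_mul_linForm_pow hd hp, hn, polyFun_homogeneous _ _ hp.1, pow_add,
      pow_mul, Complex.I_sq, ← herglotzConst_mul]
    simp only [← Complex.ofReal_one, ← Complex.ofReal_neg, ← Complex.ofReal_pow]
    generalize Complex.I ^ n = i
    set ν := (n + ((d : ℝ) - 2) / 2) with hν
    have e : ((1 / 2 : ℝ) ^ (2 * k + ν) / (k.factorial * Real.Gamma (k + ν + 1))) *
        (r ^ (2 * k) * (r ^ n * polyFun p η)) =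
        r ^ (-(((d : ℝ) - 2) / 2)) * polyFun p η * (1 /
          (k.factorial * Real.Gamma (k + ν + 1)) * (r / 2) ^ (2 * k + ν)) := by
      calc _ = ((1 / 2 : ℝ) ^ (2 * k + ν) * (r ^ (2 * k) * r ^ n)) * polyFun p η /
          (k.factorial * Real.Gamma (k + ν + 1)) := by ring
        _ = _ := by rw [← hpow]; ring
    rw [mul_assoc ((2 * Real.pi) ^ ((d : ℝ) / 2)), e]
    push_cast
    ring
  have h2 := h.tsum_eq
  simp only [Function.comp_def, hterm] at h2
  rw [← h2, tsum_mul_left, ← Complex.ofReal_tsum, radialFactor, besselJ]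
  push_cast
  ring

lemma continuous_planeWave : Continuous fun z : E d × S d => planeWave d z.1 z.2 := by
  simp only [planeWave, ContinuousMap.coe_mk]
  fun_prop

lemma herglotz_apply (u : Herglotz d) (x : E d) :
    u x = (herglotzConst d : ℂ) * inner ℂ (ContinuousMap.toLp 2 (surf d) ℂ (planeWave d x))
      ((herglotzUnitary d).symm u) := by
  rw [← herglotzWave_eq_inner, ← herglotzUnitary_apply, LinearIsometryEquiv.apply_symm_apply]

lemma continuous_herglotz (u : Herglotz d) : Continuous u := by
  have h : Continuous (planeWave d) :=
    ContinuousMap.continuous_of_continuous_uncurry _ continuous_planeWave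
  have h2 : (u : E d → ℂ) = fun x => (herglotzConst d : ℂ) *
      inner ℂ (ContinuousMap.toLp 2 (surf d) ℂ (planeWave d x)) ((herglotzUnitary d).symm u) :=
    funext (herglotz_apply u)
  rw [h2]
  fun_prop

lemma reproKernel_inner (x : E d) (u : Herglotz d) : inner ℂ (reproKernel d x) u = u x := by
  simp [reproKernel]

lemma conj_reproKernel (x y : E d) : conj (reproKernel d x y) = reproKernel d y x := by
  rw [← reproKernel_inner y, inner_conj_symm, reproKernel_inner]

lemma reproKernel_eq (x : E d) : reproKernel d x = (herglotzConst d : ℂ) •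
    herglotzUnitary d (ContinuousMap.toLp 2 (surf d) ℂ (planeWave d x)) := by
  refine ext_inner_right ℂ fun u => ?_
  rw [reproKernel_inner, inner_smul_left, herglotz_apply, Complex.conj_ofReal,
    ← (herglotzUnitary d).symm.inner_map_map, LinearIsometryEquiv.symm_apply_apply]

lemma reproKernel_apply (x y : E d) : reproKernel d x y = (herglotzConst d : ℂ) *
    ((herglotzConst d : ℂ) * ∫ ξ, planeWave d x ξ * conj (planeWave d y ξ) ∂(surf d)) := by
  rw [reproKernel_eq, herglotz_apply, map_smul, LinearIsometryEquiv.symm_apply_apply,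
    inner_smul_right, ContinuousMap.inner_toLp]

lemma herglotzWave_polyL2 (p : MvPolynomial (Fin d) ℝ) (x : E d) :
    herglotzWave d (polyL2 p) x =
      (herglotzConst d : ℂ) * ∫ ξ, polyFun p ξ * conj (planeWave d x ξ) ∂(surf d) := by
  rw [herglotzWave_eq_inner, polyL2_apply, toL2S, ContinuousMap.inner_toLp]
  rfl

/-- Integrating a spherical harmonic against the reproducing kernel over the sphere of radius `r`
gives the Herglotz wave of that harmonic: after Fubini, the integral over the sphere of radius `r`
is, up to conjugation, a value of the same wave, by the symmetry of `exp (i r η·ξ)` in `η` and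
`ξ`. -/
lemma integral_polyFun_mul_reproKernel (hd : 0 < d) {n : ℕ} {p : MvPolynomial (Fin d) ℝ}
    (hp : p ∈ harmonicPoly d n) {r : ℝ} (hr : 0 < r) (x : E d) :
    ∫ η : S d, polyFun p η * reproKernel d (r • (η : E d)) x ∂(surf d) =
      conj ((√Real.pi : ℂ) * Complex.I ^ n * radialFactor d n r) * herglotzWave d (polyL2 p) x := by
  have hpc : Continuous fun ξ : S d => ((polyFun p ξ : ℝ) : ℂ) :=
    Complex.continuous_ofReal.comp (continuous_polyFun_sphere p)
  have hsymm : ∀ η ξ : S d, planeWave d (r • (η : E d)) ξ = planeWave d (r • (ξ : E d)) η := by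
    intro η ξ
    simp only [planeWave, ContinuousMap.coe_mk, inner_smul_left, real_inner_comm]
  have hin : ∀ ξ : S d, (herglotzConst d : ℂ) *
      ∫ η : S d, polyFun p η * planeWave d (r • (η : E d)) ξ ∂(surf d) =
      conj ((√Real.pi : ℂ) * Complex.I ^ n * radialFactor d n r) * polyFun p ξ := by
    intro ξ
    have h := congrArg conj (herglotzWave_polyL2_smul hd hp hr ξ)
    rw [herglotzWave_polyL2, map_mul, map_mul, Complex.conj_ofReal, Complex.conj_ofReal,
      ← integral_conj] at h
    rw [← h]
    congr 2
    ext η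
    rw [map_mul, Complex.conj_conj, Complex.conj_ofReal, hsymm]
  have hcont : Continuous (Function.uncurry fun η ξ : S d => (polyFun p η : ℂ) *
      (planeWave d (r • (η : E d)) ξ * conj (planeWave d x ξ))) := by
    refine (hpc.comp continuous_fst).mul (Continuous.mul ?_ ?_)
    · exact continuous_planeWave.comp (f := fun z : S d × S d => (r • (z.1 : E d), z.2))
        (by fun_prop)
    · exact Complex.continuous_conj.comp ((planeWave d x).continuous.comp continuous_snd)
  calc ∫ η : S d, polyFun p η * reproKernel d (r • (η : E d)) x ∂(surf d)
      = (herglotzConst d : ℂ) * ((herglotzConst d : ℂ) * ∫ η : S d, ∫ ξ : S d, (polyFun p η : ℂ) *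
          (planeWave d (r • (η : E d)) ξ * conj (planeWave d x ξ)) ∂(surf d) ∂(surf d)) := by
        rw [← integral_const_mul, ← integral_const_mul]
        congr 1
        ext η
        rw [reproKernel_apply, integral_const_mul]
        ring
    _ = (herglotzConst d : ℂ) * ((herglotzConst d : ℂ) * ∫ ξ : S d, ∫ η : S d, (polyFun p η : ℂ) *
          (planeWave d (r • (η : E d)) ξ * conj (planeWave d x ξ)) ∂(surf d) ∂(surf d)) := by
        rw [integral_integral_swap_of_hasCompactSupport hcont (HasCompactSupport.of_compactSpace _)]
    _ = (herglotzConst d : ℂ) * ∫ ξ : S d, ((herglotzConst d : ℂ) *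
          ∫ η : S d, polyFun p η * planeWave d (r • (η : E d)) ξ ∂(surf d)) *
            conj (planeWave d x ξ) ∂(surf d) := by
        rw [← integral_const_mul]
        congr 2
        ext ξ
        rw [mul_assoc, ← integral_mul_const]
        simp only [mul_assoc]
    _ = _ := by
        simp only [hin]
        rw [herglotzWave_polyL2, mul_left_comm, ← integral_const_mul]
        simp only [mul_assoc, integral_const_mul]

lemma integrableOn_ball_form {a : ℝ → ℂ}
    (ha : LocallyIntegrable (fun x : E d => a ‖x‖) volume) (u : Herglotz d) (x : E d) (R : ℝ) :
    IntegrableOn (fun y : E d => a ‖y‖ * u y * conj (reproKernel d x y))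
      (Metric.ball (0 : E d) R) := by
  have hc := isCompact_closedBall (0 : E d) R
  have h := ((ha.integrableOn_isCompact hc).mul_continuousOn
    (continuous_herglotz u).continuousOn hc).mul_continuousOn
      (Complex.continuous_conj.comp (continuous_herglotz (reproKernel d x))).continuousOn hc
  exact h.mono_set Metric.ball_subset_closedBall

/-- The form of the Toeplitz operator on a spherical harmonic, over the ball of radius `R`. -/
lemma setIntegral_ball_herglotzWave (hd : 2 ≤ d) {a : ℝ → ℂ}
    (ha : LocallyIntegrable (fun x : E d => a ‖x‖) volume) {n : ℕ} {p : MvPolynomial (Fin d) ℝ}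
    (hp : p ∈ harmonicPoly d n) {u : Herglotz d} (hu : u = herglotzUnitary d (polyL2 p)) (x : E d)
    {R : ℝ} (hR : 0 ≤ R) :
    ∫ y in Metric.ball (0 : E d) R, a ‖y‖ * u y * conj (reproKernel d x y) =
      ((Real.pi : ℂ) * ∫ r in (0 : ℝ)..R,
        a r * ((besselJ (n + ((d : ℝ) - 2) / 2) r ^ 2 * r : ℝ) : ℂ)) * u x := by
  have hint := integrableOn_ball_form ha u x R
  rw [← integral_indicator measurableSet_ball,
    integral_polar (by omega) (hint.integrable_indicator measurableSet_ball),
    intervalIntegral.integral_of_le hR, integral_Ioc_eq_integral_Ioo,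
    ← integral_const_mul, ← integral_mul_const, ← Set.Ioi_inter_Iio,
    ← setIntegral_indicator measurableSet_Iio]
  refine setIntegral_congr_fun measurableSet_Ioi fun r hr => ?_
  have hr0 : (0 : ℝ) < r := hr
  have hn : ∀ η : S d, ‖r • (η : E d)‖ = r := fun η => by
    rw [norm_smul, norm_eq_of_mem_sphere, mul_one, Real.norm_of_nonneg hr0.le]
  -- the powers `r ^ (-(d - 2))` from the squared radial factor and `r ^ (d - 1)` from polar
  -- coordinates combine to the factor `r` of the Bessel integral
  by_cases hrR : r < R
  · have h1 : ∀ η : S d, (Metric.ball (0 : E d) R).indicator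
        (fun y => a ‖y‖ * u y * conj (reproKernel d x y)) (r • (η : E d)) =
        (a r * ((√Real.pi : ℂ) * Complex.I ^ n * radialFactor d n r)) *
          (polyFun p η * reproKernel d (r • (η : E d)) x) := by
      intro η
      rw [Set.indicator_of_mem (by rw [mem_ball_zero_iff, hn]; exact hrR), hn, conj_reproKernel, hu,
        herglotzUnitary_apply, herglotzWave_polyL2_smul (by omega) hp hr0]
      ring
    simp only [h1]
    rw [integral_const_mul, integral_polyFun_mul_reproKernel (by omega) hp hr0,
      Set.indicator_of_mem (by exact hrR), hu, herglotzUnitary_apply]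
    generalize herglotzWave d (polyL2 p) x = w
    have hJ : r ^ (d - 1) * (√Real.pi * √Real.pi * radialFactor d n r ^ 2) =
        Real.pi * (besselJ (n + ((d : ℝ) - 2) / 2) r ^ 2 * r) := by
      rw [Real.mul_self_sqrt Real.pi_pos.le, radialFactor, mul_pow, ← Real.rpow_natCast _ 2,
        ← Real.rpow_mul hr0.le]
      have : r ^ (d - 1) * r ^ (-(((d : ℝ) - 2) / 2) * (2 : ℕ)) = r := by
        rw [← Real.rpow_natCast, ← Real.rpow_add hr0]
        push_cast [Nat.cast_sub (show 1 ≤ d by omega)]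
        conv_rhs => rw [← Real.rpow_one r]
        congr 1
        ring
      calc _ = Real.pi * (besselJ (n + ((d : ℝ) - 2) / 2) r ^ 2 *
            (r ^ (d - 1) * r ^ (-(((d : ℝ) - 2) / 2) * (2 : ℕ)))) := by ring
        _ = _ := by rw [this]
    have hI : Complex.I ^ n * conj (Complex.I ^ n) = 1 := by
      rw [Complex.mul_conj, map_pow, Complex.normSq_I, one_pow, Complex.ofReal_one]
    have hJ' := congrArg (fun t : ℝ => (t : ℂ)) hJ
    simp only [Complex.ofReal_mul, Complex.ofReal_pow] at hJ'
    rw [Complex.real_smul]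
    simp only [map_mul, Complex.conj_ofReal, Complex.ofReal_mul, Complex.ofReal_pow]
    linear_combination (a r * w) * hJ' + ((r : ℂ) ^ (d - 1) * (√Real.pi * √Real.pi *
      (radialFactor d n r : ℂ) ^ 2) * a r * w) * hI
  · have h1 : ∀ η : S d, (Metric.ball (0 : E d) R).indicator
        (fun y => a ‖y‖ * u y * conj (reproKernel d x y)) (r • (η : E d)) = 0 := by
      intro η
      rw [Set.indicator_of_notMem]
      rw [mem_ball_zero_iff, hn]
      exact hrR
    simp only [h1]
    rw [integral_zero, smul_zero, Set.indicator_of_notMem (by exact hrR)]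

/-- The form of the Toeplitz operator on a spherical harmonic. -/
lemma hasForm_herglotzUnitary_polyL2 (hd : 2 ≤ d) {a : ℝ → ℂ}
    (ha : LocallyIntegrable (fun x : E d => a ‖x‖) volume) {γ : ℕ → ℂ}
    (hγ : IsSpectralSequence d a γ) {n : ℕ} {p : MvPolynomial (Fin d) ℝ}
    (hp : p ∈ harmonicPoly d n) (x : E d) :
    HasForm d a (herglotzUnitary d (polyL2 p)) (reproKernel d x)
      (γ n * herglotzUnitary d (polyL2 p) x) := by
  refine ((hγ n).mul_const _).congr' ?_
  filter_upwards [eventually_ge_atTop 0] with R hR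
  exact (setIntegral_ball_herglotzWave hd ha hp rfl x hR).symm

lemma HasForm.add {a : ℝ → ℂ} (ha : LocallyIntegrable (fun x : E d => a ‖x‖) volume)
    {u v : Herglotz d} {x : E d} {L M : ℂ} (hu : HasForm d a u (reproKernel d x) L)
    (hv : HasForm d a v (reproKernel d x) M) :
    HasForm d a (u + v) (reproKernel d x) (L + M) := by
  refine (Tendsto.add hu hv).congr fun R => ?_
  rw [← integral_add (integrableOn_ball_form ha u x R) (integrableOn_ball_form ha v x R)]
  congr 1
  ext y
  rw [RKHS.coe_add (𝕜 := ℂ), Pi.add_apply]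
  ring

lemma HasForm.smul {a : ℝ → ℂ} {u v : Herglotz d} {L : ℂ} (hu : HasForm d a u v L) (c : ℂ) :
    HasForm d a (c • u) v (c * L) := by
  refine (Tendsto.const_mul c hu).congr fun R => ?_
  rw [← integral_const_mul]
  congr 1
  ext y
  rw [RKHS.coe_smul, Pi.smul_apply, smul_eq_mul]
  ring

end Wave

/-! ### Diagonal operators on Hilbert spaces -/

section Diagonal

variable {ι H : Type*} [NormedAddCommGroup H] [InnerProductSpace ℂ H]

lemma norm_mul_apply_le {c : ι → ℂ} {C : ℝ} (hC : 0 ≤ C) (hc : ∀ i, ‖c i‖ ≤ C)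
    (f : lp (fun _ : ι => ℂ) 2) (i : ι) : ‖c i * f i‖ ≤ ‖((C : ℂ) • f) i‖ := by
  rw [lp.coeFn_smul, Pi.smul_apply, norm_smul, Complex.norm_real, Real.norm_of_nonneg hC, norm_mul]
  exact mul_le_mul_of_nonneg_right (hc i) (norm_nonneg _)

/-- Multiplication of the sequences in `ℓ²` by a bounded sequence, as a linear map. -/
def lpMulLinear (c : ι → ℂ) {C : ℝ} (hC : 0 ≤ C) (hc : ∀ i, ‖c i‖ ≤ C) :
    lp (fun _ : ι => ℂ) 2 →ₗ[ℂ] lp (fun _ : ι => ℂ) 2 where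
  toFun f := ⟨fun i => c i * f i,
    (lp.memℓp ((C : ℂ) • f)).mono' (norm_mul_apply_le hC hc f)⟩
  map_add' f g := lp.ext (funext fun i => mul_add (c i) (f i) (g i))
  map_smul' z f := lp.ext (funext fun i => mul_left_comm (c i) z (f i))

lemma norm_lpMulLinear_apply_le {c : ι → ℂ} {C : ℝ} (hC : 0 ≤ C) (hc : ∀ i, ‖c i‖ ≤ C)
    (f : lp (fun _ : ι => ℂ) 2) : ‖lpMulLinear c hC hc f‖ ≤ C * ‖f‖ := by
  refine (lp.norm_mono two_ne_zero (y := (C : ℂ) • f) (norm_mul_apply_le hC hc f)).trans ?_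
  rw [norm_smul, Complex.norm_real, Real.norm_of_nonneg hC]

/-- The operator on a Hilbert space that is diagonal with respect to a Hilbert basis, with given
bounded diagonal entries. -/
def diagonalOp (b : HilbertBasis ι ℂ H) (c : ι → ℂ) {C : ℝ} (hC : 0 ≤ C) (hc : ∀ i, ‖c i‖ ≤ C) :
    H →L[ℂ] H :=
  (b.repr.symm : lp (fun _ : ι => ℂ) 2 →L[ℂ] H) ∘L
    (lpMulLinear c hC hc).mkContinuous C (norm_lpMulLinear_apply_le hC hc) ∘L
    (b.repr : H →L[ℂ] lp (fun _ : ι => ℂ) 2)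

section

variable (b : HilbertBasis ι ℂ H) {c : ι → ℂ} {C : ℝ} (hC : 0 ≤ C) (hc : ∀ i, ‖c i‖ ≤ C)

lemma repr_diagonalOp (u : H) (i : ι) :
    b.repr (diagonalOp b c hC hc u) i = c i * b.repr u i := by
  change b.repr (b.repr.symm (lpMulLinear c hC hc (b.repr u))) i = _
  rw [LinearIsometryEquiv.apply_symm_apply]
  rfl

lemma hilbertBasis_ext {u v : H} (h : ∀ i, b.repr u i = b.repr v i) : u = v :=
  b.repr.injective (lp.ext (funext h))

lemma norm_diagonalOp_le : ‖diagonalOp b c hC hc‖ ≤ C :=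
  ContinuousLinearMap.opNorm_le_bound _ hC fun u => by
    change ‖b.repr.symm (lpMulLinear c hC hc (b.repr u))‖ ≤ _
    rw [LinearIsometryEquiv.norm_map]
    refine (norm_lpMulLinear_apply_le hC hc _).trans ?_
    rw [LinearIsometryEquiv.norm_map]

lemma diagonalOp_apply_basis (i : ι) : diagonalOp b c hC hc (b i) = c i • b i := by
  classical
  refine hilbertBasis_ext b fun j => ?_
  rw [repr_diagonalOp, map_smul, b.repr_self, lp.coeFn_smul, Pi.smul_apply, lp.single_apply,
    smul_eq_mul]
  rcases eq_or_ne j i with rfl | h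
  · rfl
  · simp [h]

lemma diagonalOp_apply_eq_smul_iff {u : H} {z : ℂ} :
    diagonalOp b c hC hc u = z • u ↔ ∀ i, c i ≠ z → b.repr u i = 0 := by
  have h : ∀ i, b.repr (z • u) i = z * b.repr u i := fun i => by simp
  constructor
  · intro hu i hi
    have h1 := repr_diagonalOp b hC hc u i
    rw [hu, h, ← sub_eq_zero, ← sub_mul] at h1
    exact (mul_eq_zero.1 h1).resolve_left (sub_ne_zero.2 hi.symm)
  · intro hu
    refine hilbertBasis_ext b fun i => ?_
    rw [repr_diagonalOp, h]
    by_cases hi : c i = z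
    · rw [hi]
    · rw [hu i hi, mul_zero, mul_zero]

lemma mem_closure_span_of_repr {u : H} {s : Set ι} (hu : ∀ i ∉ s, b.repr u i = 0) :
    u ∈ (Submodule.span ℂ (b '' s)).topologicalClosure := by
  refine (Submodule.isClosed_topologicalClosure _).mem_of_tendsto (b.hasSum_repr u)
    (Eventually.of_forall fun t => Submodule.sum_mem _ fun i _ => ?_)
  by_cases hi : i ∈ s
  · exact Submodule.smul_mem _ _ (Submodule.le_topologicalClosure _
      (Submodule.subset_span ⟨i, hi, rfl⟩))
  · rw [hu i hi, zero_smul]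
    exact Submodule.zero_mem _

/-- The spectrum of a diagonal operator is the closure of the set of its diagonal entries. -/
lemma spectrum_diagonalOp [CompleteSpace H] :
    spectrum ℂ (diagonalOp b c hC hc) = closure (Set.range c) := by
  apply subset_antisymm
  · intro z hz
    by_contra hcl
    obtain ⟨δ, hδ, hball⟩ := Metric.mem_closure_iff.not.1 hcl |> fun h => by
      push Not at h; exact h
    have hne : ∀ i, δ ≤ ‖z - c i‖ := fun i => by
      rw [← dist_eq_norm]; exact hball (c i) ⟨i, rfl⟩
    have hne0 : ∀ i, z - c i ≠ 0 := fun i h0 => by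
      have := hne i
      rw [h0, norm_zero] at this
      linarith
    -- the resolvent is diagonal with entries `(z - c i)⁻¹`, bounded by the inverse distance
    have hinv : ∀ i, ‖(z - c i)⁻¹‖ ≤ δ⁻¹ := fun i => by
      rw [norm_inv]
      exact inv_anti₀ hδ (hne i)
    have hsub : ∀ (u : H) (i : ι),
        b.repr ((algebraMap ℂ (H →L[ℂ] H) z - diagonalOp b c hC hc) u) i = (z - c i) * b.repr u i := by
      intro u i
      rw [sub_apply, map_sub, lp.coeFn_sub, Pi.sub_apply, repr_diagonalOp,
        ContinuousLinearMap.algebraMap_apply, map_smul, lp.coeFn_smul, Pi.smul_apply, smul_eq_mul]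
      ring
    refine hz (isUnit_iff_exists.2 ⟨diagonalOp b (fun i => (z - c i)⁻¹) (inv_nonneg.2 hδ.le) hinv,
      ?_, ?_⟩)
    · ext u
      refine hilbertBasis_ext b fun i => ?_
      rw [mul_apply_eq_comp, hsub, repr_diagonalOp, mul_inv_cancel_left₀ (hne0 i)]
      rfl
    · ext u
      refine hilbertBasis_ext b fun i => ?_
      rw [mul_apply_eq_comp, repr_diagonalOp, hsub, inv_mul_cancel_left₀ (hne0 i)]
      rfl
  · refine closure_minimal ?_ (spectrum.isClosed _)
    rintro _ ⟨i, rfl⟩ hu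
    have h0 : (algebraMap ℂ (H →L[ℂ] H) (c i) - diagonalOp b c hC hc) (b i) = 0 := by
      rw [sub_apply, diagonalOp_apply_basis,
        ContinuousLinearMap.algebraMap_apply, sub_self]
    obtain ⟨S, -, hS⟩ := isUnit_iff_exists.1 hu
    have h1 := congrArg (fun T : H →L[ℂ] H => T (b i)) hS
    simp only [mul_apply_eq_comp, h0, map_zero, one_apply_eq_self] at h1
    exact b.orthonormal.ne_zero i h1.symm

lemma isCompactOperator_diagonalOp_of_finite (h : {i | c i ≠ 0}.Finite) :
    IsCompactOperator (diagonalOp b c hC hc) := by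
  have hd : diagonalOp b c hC hc =
      ∑ i ∈ h.toFinset, (c i • innerSL ℂ (b i)).smulRight (b i) := by
    ext u
    refine (b.hasSum_repr (diagonalOp b c hC hc u)).unique ?_
    simp only [repr_diagonalOp, _root_.sum_apply, ContinuousLinearMap.smulRight_apply, smul_apply,
      innerSL_apply_apply, ← b.repr_apply_apply, smul_eq_mul]
    exact hasSum_sum_of_ne_finset_zero fun i hi => by
      have : c i = 0 := by simpa using hi
      simp [this]
  rw [hd]
  refine Submodule.sum_mem (compactOperator (RingHom.id ℂ) H H) fun i _ => ?_
  exact (isCompactOperator_of_locallyCompactSpace_rng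
    (ContinuousLinearMap.toSpanSingleton ℂ (b i))).comp_clm
      (c i • innerSL ℂ (b i))

/-- A diagonal operator is compact exactly when its diagonal entries tend to zero. -/
lemma isCompactOperator_diagonalOp_iff [CompleteSpace H] :
    IsCompactOperator (diagonalOp b c hC hc) ↔ Tendsto c cofinite (𝓝 0) := by
  classical
  have hfin : Tendsto c cofinite (𝓝 0) ↔ ∀ ε > 0, {i | ε ≤ ‖c i‖}.Finite := by
    rw [Metric.tendsto_nhds]
    simp [eventually_cofinite]
  rw [hfin]
  constructor
  · intro hT ε hε
    by_contra hinf
    -- infinitely many basis vectors are mapped to orthogonal vectors of norm at least `ε`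
    have hinf' : {i | ε ≤ ‖c i‖}.Infinite := hinf
    let f := hinf'.natEmbedding
    obtain ⟨K, hK, hsub⟩ := hT.image_closedBall_subset_compact
      (f := (diagonalOp b c hC hc).toLinearMap) 1
    have hmem : ∀ n, diagonalOp b c hC hc (b (f n)) ∈ K := fun n => hsub
      ⟨b (f n), by rw [mem_closedBall_zero_iff, b.orthonormal.1], rfl⟩
    obtain ⟨v, -, φ, hφ, hlim⟩ := hK.tendsto_subseq hmem
    obtain ⟨N, hN⟩ := Metric.cauchySeq_iff'.1 hlim.cauchySeq ε hε
    have h1 := hN (N + 1) (by omega)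
    have hne : (f (φ (N + 1)) : ι) ≠ f (φ N) := fun h =>
      absurd (hφ.injective (f.injective (Subtype.ext h))) (by omega)
    simp only [Function.comp_apply, diagonalOp_apply_basis, dist_eq_norm] at h1
    set j := (f (φ (N + 1)) : ι) with hj
    have h2 : inner ℂ (b j) (c j • b j - c (f (φ N)) • b (f (φ N))) = c j := by
      rw [inner_sub_right, inner_smul_right, inner_smul_right, b.orthonormal.2 hne,
        inner_self_eq_norm_sq_to_K, b.orthonormal.1]
      simp
    have h3 := norm_inner_le_norm (𝕜 := ℂ) (b j) (c j • b j - c (f (φ N)) • b (f (φ N)))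
    rw [h2, b.orthonormal.1, one_mul] at h3
    have h4 : ε ≤ ‖c j‖ := (f (φ (N + 1))).2
    linarith
  · intro h
    have hbd : ∀ (ε : ℝ) (i : ι), ‖(if ε ≤ ‖c i‖ then c i else 0 : ℂ)‖ ≤ C := by
      intro ε i
      split_ifs
      · exact hc i
      · rwa [norm_zero]
    refine isCompactOperator_of_tendsto (l := 𝓝[>] (0 : ℝ))
      (F := fun ε => diagonalOp b (fun i => if ε ≤ ‖c i‖ then c i else 0) hC (hbd ε)) ?_ ?_
    · rw [tendsto_iff_norm_sub_tendsto_zero]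
      refine squeeze_zero' (Eventually.of_forall fun _ => norm_nonneg _) ?_
        (tendsto_id.mono_left nhdsWithin_le_nhds)
      filter_upwards [self_mem_nhdsWithin] with ε (hε : 0 < ε)
      have hbd' : ∀ i, ‖(if ε ≤ ‖c i‖ then c i else 0 : ℂ) - c i‖ ≤ ε := by
        intro i
        split_ifs with hi
        · rw [sub_self, norm_zero]
          exact hε.le
        · rw [zero_sub, norm_neg]
          exact (not_le.1 hi).le
      have heq : diagonalOp b (fun i => if ε ≤ ‖c i‖ then c i else 0) hC (hbd ε) -
          diagonalOp b c hC hc = diagonalOp b _ hε.le hbd' := by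
        ext u
        refine hilbertBasis_ext b fun i => ?_
        rw [sub_apply, map_sub, lp.coeFn_sub, Pi.sub_apply]
        simp only [repr_diagonalOp, sub_mul]
      rw [heq]
      exact norm_diagonalOp_le b hε.le hbd'
    · filter_upwards [self_mem_nhdsWithin] with ε (hε : 0 < ε)
      refine isCompactOperator_diagonalOp_of_finite b hC (hbd ε) ((h ε hε).subset fun i hi => ?_)
      by_contra hlt
      exact hi (if_neg hlt)

end

end Diagonal

/-! ### The Toeplitz operator -/

section HarmonicBasis

variable {d : ℕ} {Y : (n : ℕ) → Fin (harmonicDim d n) → C(S d, ℝ)}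

/-- The Herglotz waves of an orthonormal system of spherical harmonics, as a Hilbert basis. -/
def harmonicBasis (hd : 2 ≤ d) (hY : IsHarmonicSystem d Y) :
    HilbertBasis ((n : ℕ) × Fin (harmonicDim d n)) ℂ (Herglotz d) :=
  HilbertBasis.mkOfOrthogonalEqBot (orthonormal_basisVec hd hY)
    (orthogonal_finiteCombinations hd hY)

lemma harmonicBasis_apply (hd : 2 ≤ d) (hY : IsHarmonicSystem d Y)
    (p : (n : ℕ) × Fin (harmonicDim d n)) : harmonicBasis hd hY p = basisVec d Y p.1 p.2 :=
  congrFun (HilbertBasis.coe_mkOfOrthogonalEqBot _ _) p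

lemma hasForm_basisVec (hd : 2 ≤ d) (hY : IsHarmonicSystem d Y) {a : ℝ → ℂ}
    (ha : LocallyIntegrable (fun x : E d => a ‖x‖) volume) {γ : ℕ → ℂ}
    (hγ : IsSpectralSequence d a γ) (n : ℕ) (j : Fin (harmonicDim d n)) (x : E d) :
    HasForm d a (basisVec d Y n j) (reproKernel d x) (γ n * basisVec d Y n j x) := by
  obtain ⟨p, hp, hpY⟩ := exists_mem_harmonicPoly_of_isSphericalHarmonic ((hY n).1 j)
  rw [basisVec, hpY, ← polyL2_apply]
  exact hasForm_herglotzUnitary_polyL2 hd ha hγ hp x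

/-- An operator with the right values on the basis extends the Toeplitz operator. -/
lemma extendsToeplitz_of_basisVec (hd : 2 ≤ d) (hY : IsHarmonicSystem d Y) {a : ℝ → ℂ}
    (ha : LocallyIntegrable (fun x : E d => a ‖x‖) volume) {γ : ℕ → ℂ}
    (hγ : IsSpectralSequence d a γ) {T : Herglotz d →L[ℂ] Herglotz d}
    (hT : ∀ n j, T (basisVec d Y n j) = γ n • basisVec d Y n j) :
    ExtendsToeplitz d a Y T := by
  intro u hu x
  induction hu using Submodule.span_induction with
  | mem u hu =>
    obtain ⟨⟨n, j⟩, rfl⟩ := hu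
    simp only [hT]
    rw [RKHS.coe_smul, Pi.smul_apply, smul_eq_mul]
    exact hasForm_basisVec hd hY ha hγ n j x
  | zero =>
    rw [map_zero, RKHS.coe_zero (𝕜 := ℂ), Pi.zero_apply]
    have h : (fun R : ℝ => ∫ y in Metric.ball (0 : E d) R,
        a ‖y‖ * (0 : Herglotz d) y * conj (reproKernel d x y)) = fun _ => 0 := by
      ext R
      simp [RKHS.coe_zero (𝕜 := ℂ)]
    rw [HasForm, h]
    exact tendsto_const_nhds
  | add u v _ _ hu hv =>
    rw [map_add, RKHS.coe_add (𝕜 := ℂ), Pi.add_apply]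
    exact hu.add ha hv
  | smul c u _ hu =>
    rw [map_smul, RKHS.coe_smul, Pi.smul_apply, smul_eq_mul]
    exact hu.smul c

lemma ExtendsToeplitz.eq {a : ℝ → ℂ} (hdense : (finiteCombinations d Y).topologicalClosure = ⊤)
    {T T' : Herglotz d →L[ℂ] Herglotz d} (hT : ExtendsToeplitz d a Y T)
    (hT' : ExtendsToeplitz d a Y T') : T' = T := by
  refine ContinuousLinearMap.ext_on
    (Submodule.dense_iff_topologicalClosure_eq_top.2 hdense) ?_
  rintro _ ⟨p, rfl⟩
  have hp := Submodule.subset_span (R := ℂ)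
    (Set.mem_range_self (f := fun p : (n : ℕ) × Fin (harmonicDim d n) => basisVec d Y p.1 p.2) p)
  exact RKHS.ext (𝕜 := ℂ) fun x => tendsto_nhds_unique (hT' _ hp x) (hT _ hp x)

lemma tendsto_sigma_fst_cofinite_iff (hd : 2 ≤ d) (γ : ℕ → ℂ) :
    Tendsto (fun p : (n : ℕ) × Fin (harmonicDim d n) => γ p.1) cofinite (𝓝 0) ↔
      Tendsto γ atTop (𝓝 0) := by
  rw [← Nat.cofinite_eq_atTop]
  constructor
  · intro h
    have hinj : Function.Injective fun n : ℕ =>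
        (⟨n, ⟨0, harmonicDim_pos hd n⟩⟩ : (n : ℕ) × Fin (harmonicDim d n)) :=
      fun m n hmn => congrArg Sigma.fst hmn
    exact h.comp hinj.tendsto_cofinite
  · intro h
    refine h.comp (Tendsto.cofinite_of_finite_preimage_singleton fun n => ?_)
    refine (Set.finite_range (Sigma.mk (β := fun n => Fin (harmonicDim d n)) n)).subset ?_
    rintro ⟨m, j⟩ rfl
    exact ⟨j, rfl⟩

end HarmonicBasis

end HerglotzToeplitz

end

theorem theorem4p1 (d : ℕ) (hd : 2 ≤ d) (a : ℝ → ℂ)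
    (ha : LocallyIntegrable (fun x : E d => a ‖x‖) volume)
    (γ : ℕ → ℂ) (hγ : IsSpectralSequence d a γ)
    (hbdd : ∃ C : ℝ, ∀ n, ‖γ n‖ ≤ C)
    (Y : (n : ℕ) → Fin (harmonicDim d n) → C(S d, ℝ))
    (hY : IsHarmonicSystem d Y) :
    -- the `e_{n,j}` form an orthonormal basis of the Herglotz space
    Orthonormal ℂ (fun p : (n : ℕ) × Fin (harmonicDim d n) =>
      basisVec d Y p.1 p.2) ∧
    (finiteCombinations d Y).topologicalClosure = ⊤ ∧
    -- the Toeplitz operator has one and only one bounded extension `T`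
    ∃ T : Herglotz d →L[ℂ] Herglotz d,
      ExtendsToeplitz d a Y T ∧
      (∀ T', ExtendsToeplitz d a Y T' → T' = T) ∧
      -- it is diagonal
      (∀ n j, T (basisVec d Y n j) =
        γ n • basisVec d Y n j) ∧
      -- eigenvalues, multiplicities, eigenspaces
      (∀ n, Module.End.HasEigenvalue (T : Module.End ℂ (Herglotz d)) (γ n) ∧
        harmonicSpace d Y n ≤
          Module.End.eigenspace (T : Module.End ℂ (Herglotz d)) (γ n) ∧
        Module.finrank ℂ (harmonicSpace d Y n) =
          harmonicDim d n ∧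
        Module.End.eigenspace (T : Module.End ℂ (Herglotz d)) (γ n) =
          (⨆ m : {m : ℕ // γ m = γ n},
            harmonicSpace d Y m).topologicalClosure ∧
        ((∀ m, γ m = γ n → m = n) →
          Module.End.eigenspace (T : Module.End ℂ (Herglotz d)) (γ n) =
            harmonicSpace d Y n)) ∧
      -- spectrum
      spectrum ℂ T = closure (Set.range γ) ∧
      -- compactness
      (IsCompactOperator T ↔ Tendsto γ atTop (𝓝 0)) := by
  obtain ⟨C, hγC⟩ := hbdd
  have hC : 0 ≤ C := (norm_nonneg _).trans (hγC 0)
  have hon := orthonormal_basisVec hd hY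
  have hdense : (finiteCombinations d Y).topologicalClosure = ⊤ :=
    (Submodule.topologicalClosure_eq_top_iff).2 (orthogonal_finiteCombinations hd hY)
  let b := harmonicBasis hd hY
  have hc : ∀ p : (n : ℕ) × Fin (harmonicDim d n), ‖γ p.1‖ ≤ C := fun p => hγC p.1
  let T := diagonalOp b (fun p => γ p.1) hC hc
  have hTe : ∀ n j, T (basisVec d Y n j) = γ n • basisVec d Y n j := by
    intro n j
    have h := diagonalOp_apply_basis b hC hc ⟨n, j⟩
    rwa [harmonicBasis_apply] at h
  have hext := extendsToeplitz_of_basisVec hd hY ha hγ hTe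
  have hmem : ∀ {u : Herglotz d} {z : ℂ},
      u ∈ Module.End.eigenspace (T : Module.End ℂ (Herglotz d)) z ↔ T u = z • u :=
    Module.End.mem_eigenspace_iff
  have hclosed : ∀ z : ℂ,
      IsClosed (Module.End.eigenspace (T : Module.End ℂ (Herglotz d)) z : Set (Herglotz d)) := by
    intro z
    have h : (Module.End.eigenspace (T : Module.End ℂ (Herglotz d)) z : Set (Herglotz d)) =
        {u | T u = z • u} := Set.ext fun u => hmem
    rw [h]
    exact isClosed_eq T.continuous (continuous_const_smul z)
  have hle : ∀ n, harmonicSpace d Y n ≤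
      Module.End.eigenspace (T : Module.End ℂ (Herglotz d)) (γ n) := by
    intro n
    refine Submodule.span_le.2 ?_
    rintro _ ⟨j, rfl⟩
    exact hmem.2 (hTe n j)
  have heig : ∀ n, Module.End.eigenspace (T : Module.End ℂ (Herglotz d)) (γ n) =
      (⨆ m : {m : ℕ // γ m = γ n}, harmonicSpace d Y m).topologicalClosure := by
    intro n
    apply le_antisymm
    · intro u hu
      have hrepr := (diagonalOp_apply_eq_smul_iff b hC hc).1 (hmem.1 hu)
      refine Submodule.topologicalClosure_mono ?_
        (mem_closure_span_of_repr b (s := {p | γ p.1 = γ n}) hrepr)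
      refine Submodule.span_le.2 ?_
      rintro _ ⟨⟨m, j⟩, hm, rfl⟩
      refine Submodule.mem_iSup_of_mem (⟨m, hm⟩ : {m : ℕ // γ m = γ n}) ?_
      rw [harmonicBasis_apply]
      exact Submodule.subset_span ⟨j, rfl⟩
    · refine Submodule.topologicalClosure_minimal _ (iSup_le fun m => ?_) (hclosed _)
      exact (hle m).trans_eq (by rw [m.2])
  refine ⟨hon, hdense, T, hext, fun T' hT' => hext.eq hdense hT', hTe, fun n => ⟨?_, hle n, ?_,
    heig n, fun huniq => ?_⟩, ?_, ?_⟩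
  · exact Module.End.hasEigenvalue_of_hasEigenvector
      ⟨hmem.2 (hTe n ⟨0, harmonicDim_pos hd n⟩), hon.ne_zero ⟨n, ⟨0, harmonicDim_pos hd n⟩⟩⟩
  · have hli : LinearIndependent ℂ (basisVec d Y n) :=
      (hon.comp (fun j => (⟨n, j⟩ : (n : ℕ) × Fin (harmonicDim d n)))
        fun _ _ h => eq_of_heq (Sigma.mk.inj h).2).linearIndependent
    rw [harmonicSpace, finrank_span_eq_card hli, Fintype.card_fin]
  · refine le_antisymm ?_ (hle n)
    rw [heig n]
    have : FiniteDimensional ℂ (harmonicSpace d Y n) :=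
      FiniteDimensional.span_of_finite ℂ (Set.finite_range _)
    refine Submodule.topologicalClosure_minimal _ (iSup_le fun m => ?_)
      (Submodule.closed_of_finiteDimensional _)
    rw [huniq m m.2]
  · rw [spectrum_diagonalOp b hC hc]
    congr 1
    ext z
    constructor
    · rintro ⟨p, rfl⟩
      exact ⟨p.1, rfl⟩
    · rintro ⟨n, rfl⟩
      exact ⟨⟨n, ⟨0, harmonicDim_pos hd n⟩⟩, rfl⟩
  · rw [isCompactOperator_diagonalOp_iff b hC hc]
    exact tendsto_sigma_fst_cofinite_iff hd γ
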